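/- **Setting.** Write $(a,b)^\perp=(-b,a)$ and $\mathbf v(\omega)=(\cos\omega,\sin\omega)$. Let $\Gamma$ be a convex plane arc of class $C^5$, parametrized counterclockwise by arc length $s\in[0,|\Gamma|]$, whose tangent angle $\theta$ increases (weakly) from $\theta(0)=0$ to $\theta(|\Gamma|)=\pi$, which is symmetric about the horizontal axis $\{y=0\}$, has both end points on $\{x=0\}$, and has vanishing curvature at both end points (for instance a suitably smoothed semi-circle). Let $W$ be the distance of its end points. For $L>0$ the stadium-like billiard table with separation distance $L$ is bounded by $\Gamma$, its mirror image under $(x,y)\mapsto(-x-L,y)$, and the two horizontal walls of length $L$. Assume that there is a complete sequence of finitely many reflections off $\Gamma$ (at interior points of $\Gamma$, without tangencies, the trajectory entering and leaving through the open chord joining the end points of $\Gamma$) that is symmetric about the horizontal axis, with first reflection point $\Gamma(\hat s_0)$, pre-collisional direction angle $\hat\omega_0\in(\frac32\pi,2\pi)$, last reflection point $\Gamma(\hat s_1)$ and final direction angle $\hat\omega_1=3\pi-\hat\omega_0$ (modulo $2\pi$). For nearby trajectories with first reflection point $\Gamma(s_0)$, pre-collisional direction angle $\omega_0$, last reflection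 point $\Gamma(s_1)$ and final direction angle $\omega_1$, use the coordinates $$\mathsf x_i=[\Gamma(s_i)-\Gamma(\hat s_i)]\cdot\mathbf v(\omega_i)^\perp,\qquad \mathsf y_i=\omega_i-\hat\omega_i\qquad(i=0,1),$$ and let $\mathsf F:(\mathsf x_0,\mathsf y_0)\mapsto(\mathsf x_1,\mathsf y_1)$ be the billiard map along the sequence of reflections, so $\mathsf F(0,0)=(0,0)$. Assume that $$D\mathsf F(0,0)=\begin{pmatrix}-1&a_{01}\\0&-1\end{pmatrix}\ \text{ with } a_{01}\ne0,\qquad\text{and}\qquad a_{20}:=\tfrac12\,\partial^2_{\mathsf x}\mathsf F_{\mathsf x}(0,0)\neq0 .$$ There are $\varepsilon,\delta>0$ and a $C^4$ function $f:(-\varepsilon,\varepsilon)\to(-\delta,\delta)$ with $f(0)=0$, $f'(0)=\frac12a_{01}$, such that for $|\mathsf x|<\delta$, $|\mathsf y|<\varepsilon$ one has $\mathsf F(\mathsf x,\mathsf y)=(\mathsf x,-\mathsf y)$ if and only if $\mathsf x=f(\mathsf y)$. For $n\in\mathbb N$ and $|\bar{\mathsf y}_0|<\varepsilon$ put $$L_n(\bar{\mathsf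 y}_0)=\frac{2f(\bar{\mathsf y}_0)+nW\cos(\hat\omega_1-\bar{\mathsf y}_0)+2\,\Gamma(\hat s_1)\cdot\mathbf v(\hat\omega_1-\bar{\mathsf y}_0)^\perp}{\sin(\hat\omega_1-\bar{\mathsf y}_0)} .$$ Let $\mathsf T_{\bar{\mathsf y}_0}$ (depending on $n$) be the first return map on the table with separation distance $L_n(\bar{\mathsf y}_0)$, in the coordinates $(\delta\mathsf x,\delta\mathsf y)=(\mathsf x_0,\mathsf y_0)-(f(\bar{\mathsf y}_0),\bar{\mathsf y}_0)$: it is $\mathsf F$ followed by the free flight across the channel on the unfolded table, where the post-collisional state $(s_1,\omega_1)$ goes to the pre-collisional state $(s_2,\omega_2)$ with $\Gamma(s_1)+\tau\,\mathbf v(\omega_1)=\operatorname{diag}(-1,1)\,\Gamma(s_2)-(L_n(\bar{\mathsf y}_0),\,nW)$ and $\omega_2=3\pi-\omega_1$. The monodromy matrix is $D\mathsf T_{\bar{\mathsf y}_0}(0,0)$. **Proposition.** For suitable $\varepsilon,\delta,f$ as above there are $n_0\ge1$ and functions $\bar\Upsilon_n:[-1,5]\to(-\varepsilon,\varepsilon)$,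 $n\ge n_0$, such that $\mathsf T_{\bar{\mathsf y}_0}$ is differentiable at $(0,0)$ for all $n\ge n_0$ and $|\bar{\mathsf y}_0|<\varepsilon$, and such that for all $n\ge n_0$, $t\in[-1,5]$, $|\bar{\mathsf y}_0|<\varepsilon$, $$\operatorname{tr}D\mathsf T_{\bar{\mathsf y}_0}(0,0)=2-t\iff\bar{\mathsf y}_0=\bar\Upsilon_n(t).$$ For $n\ge n_0$ and $-3\le\Theta\le3$ put $\bar{\mathsf y}_0=\bar\Upsilon_n(2-\Theta)$. Then $L_n(\bar{\mathsf y}_0)>0$; on the table with separation distance $L_n(\bar{\mathsf y}_0)$ the trajectory whose sequence of reflections off $\Gamma$ starts with the coordinates $(\mathsf x_0,\mathsf y_0)=(f(\bar{\mathsf y}_0),\bar{\mathsf y}_0)$ is a periodic billiard orbit (with period $2(N+n)$, not necessarily minimal, where $N$ is the number of reflections in the given sequence); $\mathsf T_{\bar{\mathsf y}_0}(0,0)=(0,0)$; and $\operatorname{tr}D\mathsf T_{\bar{\mathsf y}_0}(0,0)=\Theta$. Moreover, there is a constant $K$ such that for all $n\ge n_0$ and all $-3\le\Theta\le3$ $$\Big|L_n\big(\bar\Upsilon_n(2-\Theta)\big)-L_n(0)-\frac{2-\Theta}{2\,a_{20}\sin\hat\omega_1}\Big|\le\frac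 Kn .$$ -/

import Mathlib

open Set

/-! ## Plane vectors -/

/-- The unit vector with direction angle `ω`. -/
noncomputable def dir (ω : ℝ) : ℝ × ℝ := (Real.cos ω, Real.sin ω)

/-- `(a, b)^⊥ = (-b, a)`. -/
def perp (v : ℝ × ℝ) : ℝ × ℝ := (-v.2, v.1)

/-- The Euclidean scalar product of the plane. -/
def dot (v w : ℝ × ℝ) : ℝ := v.1 * w.1 + v.2 * w.2

/-! ## The curved boundary component and the stadium-like table -/

/-- The right curved boundary component `Γ` of a `C²` stadium-like table: a convex `C⁵` arc,
parametrized counterclockwise by arc length on `[0, len]`, with tangent angle `θ` running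
monotonically from `0` (bottom end) to `π` (top end), symmetric about the horizontal axis `y = 0`,
with both end points on the line `x = 0`, and with curvature vanishing at both end points
(the signed curvature of the arc is `-θ'`). -/
structure CurvedComponent where
  /-- total arc length -/
  len : ℝ
  len_pos : 0 < len
  /-- the arc length parametrization -/
  Γ : ℝ → ℝ × ℝ
  /-- the tangent angle -/
  θ : ℝ → ℝ
  contDiffOn_Γ : ContDiffOn ℝ 5 Γ (Icc 0 len)
  contDiffOn_θ : ContDiffOn ℝ 4 θ (Icc 0 len)
  hasDerivWithinAt_Γ : ∀ s ∈ Icc 0 len, HasDerivWithinAt Γ (dir (θ s)) (Icc 0 len) s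
  monotoneOn_θ : MonotoneOn θ (Icc 0 len)
  θ_zero : θ 0 = 0
  θ_len : θ len = Real.pi
  curvature_zero : derivWithin θ (Icc 0 len) 0 = 0
  curvature_len : derivWithin θ (Icc 0 len) len = 0
  Γ_zero_fst : (Γ 0).1 = 0
  symmetric : ∀ s ∈ Icc 0 len, Γ (len - s) = ((Γ s).1, -(Γ s).2)

namespace CurvedComponent

/-- The width of the channel, i.e. the distance of the two parallel walls. -/
def width (C : CurvedComponent) : ℝ := (C.Γ C.len).2 - (C.Γ 0).2

/-- The open chord joining the two end points of `Γ`. -/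
def openChord (C : CurvedComponent) : Set (ℝ × ℝ) :=
  {p | p.1 = 0 ∧ -(C.width / 2) < p.2 ∧ p.2 < C.width / 2}

/-- `p` is a point of the boundary of the table with separation distance `L` and `t` is a unit
tangent vector of that boundary at `p`. The boundary consists of `Γ`, of its mirror image
`(x, y) ↦ (-x - L, y)`, and of the two walls of length `L`. -/
def IsBoundaryTangent (C : CurvedComponent) (L : ℝ) (p t : ℝ × ℝ) : Prop :=
  (∃ s ∈ Icc 0 C.len, p = C.Γ s ∧ t = dir (C.θ s)) ∨
  (∃ s ∈ Icc 0 C.len, p = (-(C.Γ s).1 - L, (C.Γ s).2) ∧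
    t = (-Real.cos (C.θ s), Real.sin (C.θ s))) ∨
  (p.1 ∈ Icc (-L) 0 ∧ (p.2 = C.width / 2 ∨ p.2 = -(C.width / 2)) ∧ t = (1, 0))

/-- The boundary of the (convex) table with separation distance `L`. -/
def tableBoundary (C : CurvedComponent) (L : ℝ) : Set (ℝ × ℝ) :=
  {p | ∃ t, C.IsBoundaryTangent L p t}

/-- One step of the billiard on the table with separation distance `L`. A state `(p, v)` is a
boundary point together with a post-collisional velocity. The particle flies from `p` along `v`
to the next boundary point, where it is reflected specularly. -/
def BilliardStep (C : CurvedComponent) (L : ℝ) (z z' : (ℝ × ℝ) × (ℝ × ℝ)) : Prop :=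
  z.1 ∈ C.tableBoundary L ∧
  (∃ τ : ℝ, 0 < τ ∧ z'.1 = z.1 + τ • z.2) ∧
  Disjoint (openSegment ℝ z.1 z'.1) (C.tableBoundary L) ∧
  ∃ t, C.IsBoundaryTangent L z'.1 t ∧ z'.2 = (2 * dot z.2 t) • t - z.2

/-- `z` is a periodic billiard orbit with (not necessarily minimal) period `P` on the table with
separation distance `L`. -/
def IsPeriodicOrbit (C : CurvedComponent) (L : ℝ) (P : ℕ) (z : ℕ → (ℝ × ℝ) × (ℝ × ℝ)) : Prop :=
  0 < P ∧ (∀ k, C.BilliardStep L (z k) (z (k + 1))) ∧ ∀ k, z (k + P) = z k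

/-! ## Reflections off `Γ`

An oriented line is recorded as `(c, ω)`: it has direction `dir ω` and consists of the points `p`
with `p · (dir ω)^⊥ = c`. -/

/-- The oriented line `z` hits `Γ` from the inside at the (interior) point with parameter `s`: it
passes through `Γ s`, and its direction points strictly to the outer side there (`Γ` has inner
normal `(dir θ)^⊥`). As `Γ` is convex with total turning `π`, there is at most one such `s`. -/
def IsHit (C : CurvedComponent) (z : ℝ × ℝ) (s : ℝ) : Prop :=
  s ∈ Ioo 0 C.len ∧ dot (C.Γ s) (perp (dir z.2)) = z.1 ∧ Real.sin (z.2 - C.θ s) < 0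

/-- The parameter at which the oriented line `z` hits `Γ` (junk value if it does not). -/
noncomputable def hit (C : CurvedComponent) (z : ℝ × ℝ) : ℝ := Classical.epsilon (C.IsHit z)

/-- Specular reflection off `Γ` of the oriented line `z` at its hitting point. -/
noncomputable def reflectLine (C : CurvedComponent) (z : ℝ × ℝ) : ℝ × ℝ :=
  (dot (C.Γ (C.hit z)) (perp (dir (2 * C.θ (C.hit z) - z.2))), 2 * C.θ (C.hit z) - z.2)

/-- The post-collisional state (point and velocity) of the particle that moves along `z` and is
reflected off `Γ`. -/
noncomputable def stateAfter (C : CurvedComponent) (z : ℝ × ℝ) : (ℝ × ℝ) × (ℝ × ℝ) :=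
  (C.Γ (C.hit z), dir (C.reflectLine z).2)

/-- Free flight across the channel on the unfolded table. In the unfolding (in the vertical
direction `n` times about the walls, then to the left) the next copy of `Γ` is
`{(-Γ_x, Γ_y) - (L, n W)}`, so a point `p` of the plane has coordinates
`mirror (p + (L, n W))` relative to that copy, `mirror (x, y) = (-x, y)`, and a flight with
direction `ω` has direction `3π - ω` relative to it. The line `z` passes through the point
`z.1 • (dir z.2)^⊥`; the result is the same line relative to the next copy. -/
noncomputable def freeFlight (C : CurvedComponent) (L : ℝ) (n : ℕ) (z : ℝ × ℝ) : ℝ × ℝ :=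
  let p : ℝ × ℝ := z.1 • perp (dir z.2) + (L, n * C.width)
  (dot (-p.1, p.2) (perp (dir (3 * Real.pi - z.2))), 3 * Real.pi - z.2)

end CurvedComponent

/-! ## The reference trajectory and the maps attached to it -/

/-- A complete sequence of reflections off `Γ`, symmetric about the horizontal axis, at the
parameters `s 0, …, s last`. Here `ω 0` is the direction angle before the first reflection and
`ω (k + 1)` the one after the reflection at `s k`. Completeness: the trajectory comes in and goes
out through the open chord of `Γ`. -/
structure CompleteSymmetricSequence (C : CurvedComponent) where
  last : ℕ
  s : ℕ → ℝ
  ω : ℕ → ℝ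
  s_mem : ∀ k ≤ last, s k ∈ Ioo 0 C.len
  incoming : ∀ k ≤ last, Real.sin (ω k - C.θ (s k)) < 0
  reflection : ∀ k ≤ last, ω (k + 1) = 2 * C.θ (s k) - ω k
  flight : ∀ k < last, ∃ τ : ℝ, 0 < τ ∧ C.Γ (s (k + 1)) = C.Γ (s k) + τ • dir (ω (k + 1))
  comes_in : ∃ τ : ℝ, 0 < τ ∧ C.Γ (s 0) - τ • dir (ω 0) ∈ C.openChord
  goes_out : ∃ τ : ℝ, 0 < τ ∧ C.Γ (s last) + τ • dir (ω (last + 1)) ∈ C.openChord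
  symmetric : ∀ k ≤ last, s (last - k) = C.len - s k
  angle_gt : 3 / 2 * Real.pi < ω 0
  angle_lt : ω 0 < 2 * Real.pi
  angle_out : ∃ j : ℤ, ω (last + 1) = 3 * Real.pi - ω 0 + 2 * Real.pi * j

namespace CompleteSymmetricSequence

variable {C : CurvedComponent}

/-- The final direction angle `ω̂₁ = 3π - ω̂₀` (`ω (last + 1)`, normalized to `(π, 3π/2)`). -/
noncomputable def ωOut (O : CompleteSymmetricSequence C) : ℝ := 3 * Real.pi - O.ω 0

/-- The incoming oriented line with local coordinates `(x₀, y₀)`, where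
`x₀ = (Γ(s₀) - Γ(ŝ₀)) · (dir ω₀)^⊥` and `y₀ = ω₀ - ω̂₀`. -/
noncomputable def inLine (O : CompleteSymmetricSequence C) (q : ℝ × ℝ) : ℝ × ℝ :=
  (q.1 + dot (C.Γ (O.s 0)) (perp (dir (O.ω 0 + q.2))), O.ω 0 + q.2)

/-- The local coordinates `(x₀, y₀)` of an incoming oriented line; inverse of `inLine`. -/
noncomputable def inCoord (O : CompleteSymmetricSequence C) (z : ℝ × ℝ) : ℝ × ℝ :=
  (z.1 - dot (C.Γ (O.s 0)) (perp (dir z.2)), z.2 - O.ω 0)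

/-- The outgoing oriented line with local coordinates `(x₁, y₁)`, where
`x₁ = (Γ(s₁) - Γ(ŝ₁)) · (dir ω₁)^⊥` and `y₁ = ω₁ - ω̂₁`. -/
noncomputable def outLine (O : CompleteSymmetricSequence C) (q : ℝ × ℝ) : ℝ × ℝ :=
  (q.1 + dot (C.Γ (O.s O.last)) (perp (dir (O.ωOut + q.2))), O.ωOut + q.2)

/-- The billiard map `(x₀, y₀) ↦ (x₁, y₁)` along the sequence of reflections off `Γ`, in local
coordinates. -/
noncomputable def F (O : CompleteSymmetricSequence C) (q : ℝ × ℝ) : ℝ × ℝ :=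
  let z := C.reflectLine^[O.last + 1] (O.inLine q)
  (z.1 - dot (C.Γ (O.s O.last)) (perp (dir z.2)), z.2 - O.ω (O.last + 1))

/-- The coefficient `a₂₀` of `x₀²` in the Taylor expansion of the first component of `F`. -/
noncomputable def a20 (O : CompleteSymmetricSequence C) : ℝ :=
  iteratedDeriv 2 (fun x : ℝ => (O.F (x, 0)).1) 0 / 2

/-- The linearization of the billiard flow along the sequence of reflections (in Jacobi
coordinates) is the matrix with rows `(-1, β)` and `(0, -1)`. -/
def HasLinearization (O : CompleteSymmetricSequence C) (β : ℝ) : Prop :=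
  HasFDerivAt O.F
    ((-ContinuousLinearMap.fst ℝ ℝ ℝ + β • ContinuousLinearMap.snd ℝ ℝ ℝ).prod
      (-ContinuousLinearMap.snd ℝ ℝ ℝ)) 0

/-- `f` is the function on `(-ε, ε)` whose graph `x = f(y)` consists, among all `(x, y)` with
`|x| < δ`, `|y| < ε`, of the solutions of `F(x, y) = (x, -y)`. -/
def IsSymmetryFunction (O : CompleteSymmetricSequence C) (β ε δ : ℝ) (f : ℝ → ℝ) : Prop :=
  f 0 = 0 ∧ HasDerivAt f (β / 2) 0 ∧ ContDiffOn ℝ 4 f (Ioo (-ε) ε) ∧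
  ∀ y ∈ Ioo (-ε) ε, f y ∈ Ioo (-δ) δ ∧ ∀ x ∈ Ioo (-δ) δ, O.F (x, y) = (x, -y) ↔ x = f y

/-- The separation distance `L_n(y)`, with `f` as in `IsSymmetryFunction`. -/
noncomputable def sep (O : CompleteSymmetricSequence C) (f : ℝ → ℝ) (n : ℕ) (y : ℝ) : ℝ :=
  (2 * f y + n * C.width * Real.cos (O.ωOut - y)
    + 2 * dot (C.Γ (O.s O.last)) (perp (dir (O.ωOut - y)))) / Real.sin (O.ωOut - y)

/-- The first return map (reflections off `Γ`, then free flight across the channel) on the table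
with separation distance `L_n(y)`, in the coordinates `(δx, δy)` centred at `(f(y), y)`. -/
noncomputable def returnMap (O : CompleteSymmetricSequence C) (f : ℝ → ℝ) (n : ℕ) (y : ℝ)
    (q : ℝ × ℝ) : ℝ × ℝ :=
  O.inCoord (C.freeFlight (O.sep f n y) n (O.outLine (O.F ((f y, y) + q)))) - (f y, y)

/-- The trace of the monodromy matrix `D T_y(0, 0)`. -/
noncomputable def monodromyTrace (O : CompleteSymmetricSequence C) (f : ℝ → ℝ) (n : ℕ)
    (y : ℝ) : ℝ :=
  LinearMap.trace ℝ (ℝ × ℝ) (fderiv ℝ (O.returnMap f n y) 0 : (ℝ × ℝ) →ₗ[ℝ] (ℝ × ℝ))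

end CompleteSymmetricSequence

open Filter Topology

/-! ## Linear algebra of the plane -/

/-! The billiard map `F` has two structural properties. It preserves area (`planeDet_fderiv_F`), and
the symmetry of `Γ` combined with time reversal makes it reversible: with `S (x, y) = (x, -y)` one
has `F ∘ S ∘ F = S` near the origin (`F_reverse`).

Write `a, b; c, d` for the Jacobian matrix of `F`. Reversibility and determinant one give `c ∘ S ∘ F
= c` and `d ∘ S ∘ F = a` (`eventually_jac_mirrorF`). The derivative of `S ∘ F` at the origin sends
`(1, 0)` to `(-1, 0)`, so there `∂ₓc = 0` and `∂ₓd = -∂ₓa = -2 a₂₀`; moreover `∂_y c = ∂ₓd`, as both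
are second derivatives of the same component. Hence `c` vanishes at the origin and equals `-2 a₂₀ y`
to first order (`HasLinearization.fderiv_jacYX`).

The curve `x = f y` comes from the implicit function theorem for `F_x = x`. Reversibility and
injectivity of `f` (from `β ≠ 0`) upgrade this to `F (x, y) = (x, -y)`
(`HasLinearization.exists_isSymmetryFunction`). The free flight is `(x, y) ↦ (-x + g y, -y)`, and
`L_n` is chosen so that it closes the trajectory up. The trace is then `-(a + d) + g' c`, with `g'`
of leading order `n W / sin ω`.

Thus `2 - tr = P y + n Q y` and `L_n = R y + n S y` with `P 0 = Q 0 = 0`, `Q' 0 = 2 a₂₀ W / sin ω̂₁`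
and `S' 0 = W / sin² ω̂₁`. For large `n` the function `P + n Q` is strictly monotone with slope of
order `n`, so `2 - tr = t` has exactly one solution `y = O(1/n)`, and `L_n` changes by `(S' 0 / Q'
0) t + O(1/n)` (`exists_solution_of_ne_zero`).

That the fixed point is a genuine billiard orbit uses convexity: a chord that arrives transversally
does not meet the boundary in between (`BilliardStep.of_transversal`). After one passage along `Γ`
and `n` wall reflections the state is the image of the initial one under a symmetry of the table,
and two such passages close the orbit (`exists_periodic_of_involutive`). -/

theorem trace_prod_eq (A : (ℝ × ℝ) →L[ℝ] (ℝ × ℝ)) :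
    LinearMap.trace ℝ (ℝ × ℝ) (A : (ℝ × ℝ) →ₗ[ℝ] (ℝ × ℝ)) = (A (1, 0)).1 + (A (0, 1)).2 := by
  rw [LinearMap.trace_eq_matrix_trace ℝ (Module.Basis.finTwoProd ℝ)]
  simp [Matrix.trace, Fin.sum_univ_two, LinearMap.toMatrix_apply]

/-- The determinant of an endomorphism of the plane. -/
def planeDet (A : (ℝ × ℝ) →L[ℝ] (ℝ × ℝ)) : ℝ :=
  (A (1, 0)).1 * (A (0, 1)).2 - (A (0, 1)).1 * (A (1, 0)).2

theorem apply_eq_smul_add_smul {E : Type*} [NormedAddCommGroup E] [NormedSpace ℝ E]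
    (A : (ℝ × ℝ) →L[ℝ] E) (v : ℝ × ℝ) : A v = v.1 • A (1, 0) + v.2 • A (0, 1) := by
  rw [← map_smul, ← map_smul, ← map_add]
  simp

theorem planeDet_comp (A B : (ℝ × ℝ) →L[ℝ] (ℝ × ℝ)) :
    planeDet (A.comp B) = planeDet A * planeDet B := by
  simp only [planeDet, ContinuousLinearMap.comp_apply]
  rw [apply_eq_smul_add_smul A (B (1, 0)), apply_eq_smul_add_smul A (B (0, 1))]
  simp only [Prod.fst_add, Prod.snd_add, Prod.smul_fst, Prod.smul_snd, smul_eq_mul]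
  ring

/-! ## A local inverse -/

/-- Inverse function theorem for `(x, y) ↦ (h (x, y), y)`, whose derivative is triangular. It yields
both the hitting parameter on `Γ` and the symmetry function `f`; the last clause is local
uniqueness. -/
theorem exists_local_inverse {h : ℝ × ℝ → ℝ} {p : ℝ × ℝ} (hh : ContDiffAt ℝ 4 h p)
    (h0 : fderiv ℝ h p (1, 0) ≠ 0) :
    ∃ σ : ℝ × ℝ → ℝ, ContDiffAt ℝ 4 σ (h p, p.2) ∧ σ (h p, p.2) = p.1 ∧
      (∀ᶠ w in 𝓝 (h p, p.2), h (σ w, w.2) = w.1) ∧ ∀ᶠ q in 𝓝 p, σ (h q, q.2) = q.1 := by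
  set h' := fderiv ℝ h p with hh'
  have hd : HasFDerivAt h h' p := (hh.differentiableAt (by norm_num)).hasFDerivAt
  set a := h' (1, 0) with ha
  set b := h' (0, 1) with hb
  let A : (ℝ × ℝ) →L[ℝ] (ℝ × ℝ) := h'.prod (ContinuousLinearMap.snd ℝ ℝ ℝ)
  let B : (ℝ × ℝ) →L[ℝ] (ℝ × ℝ) :=
    (a⁻¹ • ContinuousLinearMap.fst ℝ ℝ ℝ - (a⁻¹ * b) • ContinuousLinearMap.snd ℝ ℝ ℝ).prod
      (ContinuousLinearMap.snd ℝ ℝ ℝ)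
  have hA : ∀ v, A v = (v.1 * a + v.2 * b, v.2) := fun v => by
    simp only [A, ContinuousLinearMap.prod_apply, ContinuousLinearMap.coe_snd']
    rw [apply_eq_smul_add_smul h' v]
    simp [ha, hb]
  have hB : ∀ v, B v = (a⁻¹ * v.1 - a⁻¹ * b * v.2, v.2) := fun v => by simp [B]
  let e : (ℝ × ℝ) ≃L[ℝ] (ℝ × ℝ) := ContinuousLinearEquiv.equivOfInverse A B
    (fun v => by rw [hB, hA]; ext <;> simp; field_simp; ring)
    (fun v => by rw [hA, hB]; ext <;> simp; field_simp; ring)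
  let φ : ℝ × ℝ → ℝ × ℝ := fun q => (h q, q.2)
  have hφ : ContDiffAt ℝ 4 φ p := hh.prodMk contDiffAt_snd
  have hφ' : HasFDerivAt φ (e : (ℝ × ℝ) →L[ℝ] (ℝ × ℝ)) p := hd.prodMk hasFDerivAt_snd
  let Φ := hφ.toOpenPartialHomeomorph φ hφ' (by norm_num)
  have hΦ : ∀ q, Φ q = φ q := fun q => rfl
  have hs : p ∈ Φ.source := hφ.mem_toOpenPartialHomeomorph_source hφ' (by norm_num)
  have ht : φ p ∈ Φ.target := hφ.image_mem_toOpenPartialHomeomorph_target hφ' (by norm_num)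
  have hsm : ContDiffAt ℝ 4 Φ.symm (φ p) := hφ.to_localInverse hφ' (by norm_num)
  refine ⟨fun w => (Φ.symm w).1, contDiffAt_fst.comp _ hsm, ?_, ?_, ?_⟩
  · change (Φ.symm (Φ p)).1 = p.1
    rw [Φ.left_inv hs]
  · filter_upwards [Φ.open_target.mem_nhds ht] with w hw
    have h1 : φ (Φ.symm w) = w := Φ.right_inv hw
    have h2 : (φ (Φ.symm w)).2 = w.2 := by rw [h1]
    have h3 : (φ (Φ.symm w)).1 = w.1 := by rw [h1]
    change (Φ.symm w).2 = w.2 at h2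
    rw [← h2]
    exact h3
  · filter_upwards [Φ.open_source.mem_nhds hs] with q hq
    change (Φ.symm (Φ q)).1 = q.1
    rw [Φ.left_inv hq]

/-! ## Solutions of an equation that depends affinely on a large parameter -/

/-- Since `deriv g` is differentiable at `0`, its increment from `0` is at most linear; the mean
value inequality for `g` and for `g x - g' 0 * x` gives the rest. One constant serves all the
bounds. -/
theorem exists_taylor_bounds {g : ℝ → ℝ} (hg : ContDiffAt ℝ 2 g 0) :
    ∃ M > 0, ∃ ε > 0, ∀ y, |y| < ε → DifferentiableAt ℝ g y ∧ |deriv g y| ≤ M ∧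
      |deriv g y - deriv g 0| ≤ M * |y| ∧ |g y - g 0| ≤ M * |y| ∧
      |g y - g 0 - deriv g 0 * y| ≤ M * y ^ 2 := by
  have h1 : ∀ᶠ y in 𝓝 (0 : ℝ), DifferentiableAt ℝ g y :=
    (hg.eventually (by decide)).mono fun y hy => hy.differentiableAt (by norm_num)
  have hg' : ContDiffAt ℝ 1 (deriv g) 0 := hg.derivWithin (by norm_num)
  obtain ⟨M₁, hM₁, h2⟩ := (hg'.differentiableAt (by norm_num)).isBigO_sub.exists_pos
  have h2 := h2.bound
  obtain ⟨ε, hε, h3⟩ := Metric.eventually_nhds_iff.1 (h1.and h2)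
  simp only [Real.dist_eq, sub_zero, Real.norm_eq_abs] at h3
  set M := M₁ + |deriv g 0| + M₁ * ε with hM
  have hM1 : M₁ ≤ M := by
    have := abs_nonneg (deriv g 0)
    have : 0 ≤ M₁ * ε := by positivity
    linarith
  have hb : ∀ y, |y| < ε → |deriv g y| ≤ M := fun y hy => by
    have h4 := (h3 hy).2
    have h5 : M₁ * |y| ≤ M₁ * ε := by gcongr
    have h6 : |deriv g y| ≤ |deriv g y - deriv g 0| + |deriv g 0| := by
      simpa using abs_add_le (deriv g y - deriv g 0) (deriv g 0)
    linarith
  refine ⟨M, by positivity, ε, hε, fun y hy => ⟨(h3 hy).1, hb y hy, ?_, ?_, ?_⟩⟩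
  · exact (h3 hy).2.trans (by gcongr)
  · have hsub : ∀ x ∈ Icc (-|y|) |y|, |x| < ε := fun x hx => (abs_le.2 hx).trans_lt hy
    have := Convex.norm_image_sub_le_of_norm_deriv_le (f := g) (s := Icc (-|y|) |y|) (C := M)
      (x := 0) (y := y) (fun x hx => (h3 (hsub x hx)).1) (fun x hx => hb x (hsub x hx))
      (convex_Icc _ _) ⟨by simp, by simp⟩ (abs_le.1 le_rfl)
    simpa using this
  · have hsub : ∀ x ∈ Icc (-|y|) |y|, |x| < ε := fun x hx => (abs_le.2 hx).trans_lt hy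
    have hd : ∀ x ∈ Icc (-|y|) |y|,
        HasDerivAt (fun x => g x - deriv g 0 * x) (deriv g x - deriv g 0) x := fun x hx => by
      have := (h3 (hsub x hx)).1.hasDerivAt.sub ((hasDerivAt_id x).const_mul (deriv g 0))
      rw [mul_one] at this
      exact this
    have := Convex.norm_image_sub_le_of_norm_deriv_le (f := fun x => g x - deriv g 0 * x)
      (s := Icc (-|y|) |y|) (C := M * |y|) (x := 0) (y := y)
      (fun x hx => (hd x hx).differentiableAt) (fun x hx => by
        rw [(hd x hx).deriv]
        have hx' := abs_le.2 hx
        exact (h3 (hsub x hx)).2.trans (by gcongr))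
      (convex_Icc _ _) ⟨by simp, by simp⟩ (abs_le.1 le_rfl)
    have h7 : M * y ^ 2 = M * |y| * |y| := by rw [mul_assoc, abs_mul_abs_self]; ring
    rw [h7]
    have h8 : g y - g 0 - deriv g 0 * y = g y - deriv g 0 * y - (g 0 - deriv g 0 * 0) := by ring
    rw [h8]
    simpa using this

/-- For large `n` the term `n Q` dominates: `P + n Q` has slope at least `n q / 4`. This gives
uniqueness, existence by the intermediate value theorem, and `|y| ≤ 4 T / (q n)`, so every Taylor
remainder, even multiplied by `n`, is `O(1/n)`. -/
theorem exists_solution_of_pos {P Q R S : ℝ → ℝ} (hP : ContDiffAt ℝ 2 P 0)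
    (hQ : ContDiffAt ℝ 2 Q 0) (hR : ContDiffAt ℝ 2 R 0) (hS : ContDiffAt ℝ 2 S 0)
    (hP0 : P 0 = 0) (hQ0 : Q 0 = 0) (hq : 0 < deriv Q 0) (T : ℝ) :
    ∃ ε₀ > 0, ∀ ε > 0, ε ≤ ε₀ → ∃ n₀ : ℕ, 0 < n₀ ∧ ∃ Υ : ℕ → ℝ → ℝ, ∃ K : ℝ, ∀ n ≥ n₀,
      ∀ t ∈ Icc (-T) T, Υ n t ∈ Ioo (-ε) ε ∧
        (∀ y ∈ Ioo (-ε) ε, P y + n * Q y = t ↔ y = Υ n t) ∧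
        |R (Υ n t) + n * S (Υ n t) - (R 0 + n * S 0) - deriv S 0 / deriv Q 0 * t| ≤ K / n := by
  obtain ⟨Mp, hMp, εp, hεp, hp⟩ := exists_taylor_bounds hP
  obtain ⟨Mq, hMq, εq, hεq, hqq⟩ := exists_taylor_bounds hQ
  obtain ⟨Mr, hMr, εr, hεr, hr⟩ := exists_taylor_bounds hR
  obtain ⟨Ms, hMs, εs, hεs, hs⟩ := exists_taylor_bounds hS
  set q := deriv Q 0 with hqdef
  set σ := deriv S 0 with hσdef
  set ε₀ := min (min (min εp εq) (min εr εs)) (q / (2 * Mq)) with hε₀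
  have hε₀pos : 0 < ε₀ := by
    refine lt_min (lt_min (lt_min ‹_› ‹_›) (lt_min ‹_› ‹_›)) (by positivity)
  refine ⟨ε₀, hε₀pos, fun ε hε hεle => ?_⟩
  have e1 : ε ≤ εp := hεle.trans ((min_le_left _ _).trans ((min_le_left _ _).trans (min_le_left _ _)))
  have e2 : ε ≤ εq := hεle.trans ((min_le_left _ _).trans ((min_le_left _ _).trans (min_le_right _ _)))
  have e3 : ε ≤ εr := hεle.trans ((min_le_left _ _).trans ((min_le_right _ _).trans (min_le_left _ _)))
  have e4 : ε ≤ εs := hεle.trans ((min_le_left _ _).trans ((min_le_right _ _).trans (min_le_right _ _)))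
  have e5 : ε ≤ q / (2 * Mq) := hεle.trans (min_le_right _ _)
  -- The first bound makes `|P'| ≤ Mp` smaller than half of the lower bound `n q / 2` for `n Q'`;
  -- the second makes the values at `±ε / 2` exceed `T` in modulus.
  obtain ⟨n₀, hn₀⟩ := exists_nat_gt (max (4 * Mp / q) (8 * T / (q * ε)))
  have hn₀pos : (0 : ℝ) < n₀ := lt_of_le_of_lt (le_max_of_le_left (by positivity)) hn₀
  set g : ℕ → ℝ → ℝ := fun n y => P y + n * Q y with hg
  have hgd : ∀ (n : ℕ) y, |y| < ε → HasDerivAt (g n) (deriv P y + n * deriv Q y) y := fun n y hy =>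
    (hp y (hy.trans_le e1)).1.hasDerivAt.add
      (((hqq y (hy.trans_le e2)).1.hasDerivAt).const_mul (n : ℝ))
  have hslope : ∀ n ≥ n₀, ∀ y, |y| < ε → n * q / 4 ≤ deriv (g n) y := fun n hn y hy => by
    rw [(hgd n y hy).deriv]
    have hn' : (n₀ : ℝ) ≤ n := by exact_mod_cast hn
    have h1 : 4 * Mp / q < n := (le_max_left _ _).trans_lt (hn₀.trans_le hn')
    rw [div_lt_iff₀ hq] at h1
    have h2 := (abs_le.1 (hp y (hy.trans_le e1)).2.1).1
    have h3 := (abs_le.1 (hqq y (hy.trans_le e2)).2.2.1).1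
    have h4 : Mq * |y| ≤ q / 2 := by
      calc Mq * |y| ≤ Mq * (q / (2 * Mq)) := by gcongr; exact hy.le.trans e5
        _ = q / 2 := by field_simp
    have h5 : q / 2 ≤ deriv Q y := by linarith
    have h6 : (n : ℝ) * (q / 2) ≤ n * deriv Q y := by gcongr
    linarith
  have hcont : ∀ n, ContinuousOn (g n) (Ioo (-ε) ε) := fun n y hy =>
    (hgd n y (abs_lt.2 hy)).continuousAt.continuousWithinAt
  have hg0 : ∀ n, g n 0 = 0 := fun n => by simp [hg, hP0, hQ0]
  have hmono : ∀ n ≥ n₀, ∀ x ∈ Ioo (-ε) ε, ∀ y ∈ Ioo (-ε) ε, x ≤ y →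
      n * q / 4 * (y - x) ≤ g n y - g n x := fun n hn =>
    (convex_Ioo (-ε) ε).mul_sub_le_image_sub_of_le_deriv (hcont n)
      (fun y hy => (hgd n y (abs_lt.2 (interior_subset (s := Ioo (-ε) ε) hy))).differentiableAt.differentiableWithinAt)
      (fun y hy => hslope n hn y (abs_lt.2 (interior_subset (s := Ioo (-ε) ε) hy)))
  have hpos : ∀ n ≥ n₀, 0 < (n : ℝ) * q / 4 := fun n hn => by
    have hn' : (n₀ : ℝ) ≤ n := by exact_mod_cast hn
    have : (0 : ℝ) < n := hn₀pos.trans_le hn'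
    positivity
  have m0 : (0 : ℝ) ∈ Ioo (-ε) ε := ⟨by linarith, hε⟩
  have hex : ∀ n ≥ n₀, ∀ t ∈ Icc (-T) T, ∃ y ∈ Ioo (-ε) ε, g n y = t := fun n hn t ht => by
    have hn' : (n₀ : ℝ) ≤ n := by exact_mod_cast hn
    have m1 : -(ε / 2) ∈ Ioo (-ε) ε := ⟨by linarith, by linarith⟩
    have m2 : ε / 2 ∈ Ioo (-ε) ε := ⟨by linarith, by linarith⟩
    have h1 := hmono n hn 0 m0 _ m2 (by linarith)
    have h2 := hmono n hn _ m1 0 m0 (by linarith)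
    have h3 : 8 * T / (q * ε) < n := (le_max_right _ _).trans_lt (hn₀.trans_le hn')
    rw [div_lt_iff₀ (by positivity)] at h3
    rw [hg0] at h1 h2
    have h4 : Icc (-(ε / 2)) (ε / 2) ⊆ Ioo (-ε) ε := fun y hy =>
      ⟨by linarith [hy.1], by linarith [hy.2]⟩
    obtain ⟨y, hy, hyt⟩ := intermediate_value_Icc (show -(ε / 2) ≤ ε / 2 by linarith)
      ((hcont n).mono h4) (show t ∈ Icc (g n (-(ε / 2))) (g n (ε / 2)) from
        ⟨by nlinarith [ht.1], by nlinarith [ht.2]⟩)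
    exact ⟨y, h4 hy, hyt⟩
  choose! Υ hΥ using hex
  have hlow : ∀ n ≥ n₀, ∀ y ∈ Ioo (-ε) ε, n * q / 4 * |y| ≤ |g n y| := fun n hn y hy => by
    rcases le_total 0 y with h | h
    · have := hmono n hn 0 m0 y hy h
      rw [hg0] at this
      rw [abs_of_nonneg h]
      exact le_trans (by linarith) (le_abs_self _)
    · have := hmono n hn y hy 0 m0 h
      rw [hg0] at this
      rw [abs_of_nonpos h]
      exact le_trans (by linarith) (neg_le_abs _)
  set Y := 4 * T / q with hY
  refine ⟨n₀, by exact_mod_cast hn₀pos, Υ,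
    Mr * Y + Ms * Y ^ 2 + |σ / q| * (Mp * Y + Mq * Y ^ 2), fun n hn t ht => ?_⟩
  obtain ⟨hy, hyt⟩ := hΥ n hn t ht
  set y := Υ n t with hydef
  refine ⟨hy, fun x hx => ⟨fun hxt => ?_, fun hxy => by rw [hxy]; exact hyt⟩, ?_⟩
  · have hxt : g n x = t := hxt
    rcases le_total x y with h | h
    · have := hmono n hn x hx y hy h
      rw [hxt, hyt, sub_self] at this
      nlinarith [hpos n hn]
    · have := hmono n hn y hy x hx h
      rw [hxt, hyt, sub_self] at this
      nlinarith [hpos n hn]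
  · have hn' : (0 : ℝ) < n := hn₀pos.trans_le (by exact_mod_cast hn)
    have hya := abs_lt.2 hy
    have hyn : |y| ≤ Y / n := by
      have h1 := hlow n hn y hy
      rw [hyt] at h1
      have h2 : |t| ≤ T := abs_le.2 ht
      rw [hY, div_div, le_div_iff₀ (by positivity)]
      linarith
    have b1 := (hp y (hya.trans_le e1)).2.2.2.1
    have b2 := (hqq y (hya.trans_le e2)).2.2.2.2
    have b3 := (hr y (hya.trans_le e3)).2.2.2.1
    have b4 := (hs y (hya.trans_le e4)).2.2.2.2
    rw [hP0, sub_zero] at b1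
    rw [hQ0, sub_zero] at b2
    have hy2 : n * y ^ 2 ≤ Y ^ 2 / n := by
      have : y ^ 2 ≤ (Y / n) ^ 2 := by rw [← sq_abs y]; gcongr
      calc (n : ℝ) * y ^ 2 ≤ n * (Y / n) ^ 2 := by gcongr
        _ = Y ^ 2 / n := by field_simp
    have hyt' : P y + n * Q y = t := hyt
    -- Substituting `t = P y + n Q y` cancels the linear parts `n σ y` of `n S` and `(σ / q) n q y`
    -- of `(σ / q) t`, leaving only terms that are `O(1/n)`.
    have key : R y + n * S y - (R 0 + n * S 0) - σ / q * t =
        (R y - R 0) + n * (S y - S 0 - σ * y) - σ / q * (P y + n * (Q y - q * y)) := by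
      rw [← hyt']; field_simp; ring
    rw [key]
    have c1 : |R y - R 0| ≤ Mr * Y / n := b3.trans (by rw [mul_div_assoc]; gcongr)
    have c2 : |n * (S y - S 0 - σ * y)| ≤ Ms * Y ^ 2 / n := by
      rw [abs_mul, abs_of_pos hn']
      calc n * |S y - S 0 - σ * y| ≤ n * (Ms * y ^ 2) := by gcongr
        _ = Ms * (n * y ^ 2) := by ring
        _ ≤ Ms * (Y ^ 2 / n) := by gcongr
        _ = _ := by ring
    have c3 : |P y| ≤ Mp * Y / n := b1.trans (by rw [mul_div_assoc]; gcongr)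
    have c4 : |n * (Q y - q * y)| ≤ Mq * Y ^ 2 / n := by
      rw [abs_mul, abs_of_pos hn']
      calc n * |Q y - q * y| ≤ n * (Mq * y ^ 2) := by gcongr
        _ = Mq * (n * y ^ 2) := by ring
        _ ≤ Mq * (Y ^ 2 / n) := by gcongr
        _ = _ := by ring
    calc _ ≤ |(R y - R 0) + n * (S y - S 0 - σ * y)| + |σ / q * (P y + n * (Q y - q * y))| :=
          abs_sub _ _
      _ ≤ (|R y - R 0| + |n * (S y - S 0 - σ * y)|)
          + |σ / q| * (|P y| + |n * (Q y - q * y)|) := by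
          rw [abs_mul]
          gcongr
          · exact abs_add_le _ _
          · exact abs_add_le _ _
      _ ≤ (Mr * Y / n + Ms * Y ^ 2 / n) + |σ / q| * (Mp * Y / n + Mq * Y ^ 2 / n) := by gcongr
      _ = _ := by ring

/-- If the slope is negative, replace `P`, `Q`, `t` by their negatives; the range of `t` is
symmetric for this reason. -/
theorem exists_solution_of_ne_zero {P Q R S : ℝ → ℝ} (hP : ContDiffAt ℝ 2 P 0)
    (hQ : ContDiffAt ℝ 2 Q 0) (hR : ContDiffAt ℝ 2 R 0) (hS : ContDiffAt ℝ 2 S 0)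
    (hP0 : P 0 = 0) (hQ0 : Q 0 = 0) (hq : deriv Q 0 ≠ 0) (T : ℝ) :
    ∃ ε₀ > 0, ∀ ε > 0, ε ≤ ε₀ → ∃ n₀ : ℕ, 0 < n₀ ∧ ∃ Υ : ℕ → ℝ → ℝ, ∃ K : ℝ, ∀ n ≥ n₀,
      ∀ t ∈ Icc (-T) T, Υ n t ∈ Ioo (-ε) ε ∧
        (∀ y ∈ Ioo (-ε) ε, P y + n * Q y = t ↔ y = Υ n t) ∧
        |R (Υ n t) + n * S (Υ n t) - (R 0 + n * S 0) - deriv S 0 / deriv Q 0 * t| ≤ K / n := by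
  rcases lt_or_gt_of_ne hq with h | h
  · have hd : deriv (fun y => -Q y) 0 = -deriv Q 0 := deriv.fun_neg
    obtain ⟨ε₀, hε₀, H⟩ := exists_solution_of_pos hP.neg hQ.neg hR hS
      (by simp [hP0]) (by simp [hQ0]) (by rw [hd]; linarith) T
    refine ⟨ε₀, hε₀, fun ε hε hle => ?_⟩
    obtain ⟨n₀, hn₀, Υ, K, H⟩ := H ε hε hle
    refine ⟨n₀, hn₀, fun n t => Υ n (-t), K, fun n hn t ht => ?_⟩
    obtain ⟨h1, h2, h3⟩ := H n hn (-t) ⟨by linarith [ht.2], by linarith [ht.1]⟩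
    refine ⟨h1, fun y hy => ?_, ?_⟩
    · rw [← h2 y hy]
      constructor <;> intro <;> linarith
    · rw [hd, div_neg, neg_mul_neg] at h3
      exact h3
  · exact exists_solution_of_pos hP hQ hR hS hP0 hQ0 h T

/-! ## Angles and directions -/

theorem dot_perp_dir (p : ℝ × ℝ) (ω : ℝ) :
    dot p (perp (dir ω)) = p.2 * Real.cos ω - p.1 * Real.sin ω := by
  simp only [dot, perp, dir]
  ring

theorem dir_add_int_mul_two_pi (ω : ℝ) (m : ℤ) : dir (ω + 2 * Real.pi * m) = dir ω := by
  have h : ω + 2 * Real.pi * m = ω + m * (2 * Real.pi) := by ring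
  simp only [dir]
  rw [h, Real.cos_add_int_mul_two_pi, Real.sin_add_int_mul_two_pi]

/-- `sin x * sin (β - α)` is a combination of `sin α` and `sin β` with nonnegative coefficients.
Length exactly `π` is excluded, because the sine would change sign between the end points. -/
theorem sin_pos_of_mem_Icc {α β x : ℝ} (hx : x ∈ Icc α β) (hαβ : β - α ≤ Real.pi)
    (hα : 0 < Real.sin α) (hβ : 0 < Real.sin β) : 0 < Real.sin x := by
  obtain ⟨h1, h2⟩ := hx
  rcases hαβ.eq_or_lt with h | h
  · have : β = α + Real.pi := by linarith
    rw [this, Real.sin_add_pi] at hβ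
    linarith
  rcases h1.eq_or_lt with h3 | h3
  · rwa [← h3]
  have h4 : Real.sin x * Real.sin (β - α) =
      Real.sin α * Real.sin (β - x) + Real.sin β * Real.sin (x - α) := by
    simp only [Real.sin_sub]
    ring
  have h5 : 0 < Real.sin (β - α) := Real.sin_pos_of_pos_of_lt_pi (by linarith) h
  have h6 : 0 ≤ Real.sin (β - x) := Real.sin_nonneg_of_nonneg_of_le_pi (by linarith) (by linarith)
  have h7 : 0 < Real.sin (x - α) := Real.sin_pos_of_pos_of_lt_pi (by linarith) (by linarith)
  have h8 : 0 < Real.sin x * Real.sin (β - α) := by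
    rw [h4]
    positivity
  exact pos_of_mul_pos_left h8 h5.le

namespace CurvedComponent

variable (C : CurvedComponent)

/-! ## Geometry of the arc -/

theorem zero_mem : (0 : ℝ) ∈ Icc 0 C.len := ⟨le_rfl, C.len_pos.le⟩

theorem len_mem : C.len ∈ Icc 0 C.len := ⟨C.len_pos.le, le_rfl⟩

variable {C}

theorem len_sub_mem {s : ℝ} (hs : s ∈ Icc 0 C.len) : C.len - s ∈ Icc 0 C.len :=
  ⟨by linarith [hs.2], by linarith [hs.1]⟩

theorem θ_mem {s : ℝ} (hs : s ∈ Icc 0 C.len) : C.θ s ∈ Icc 0 Real.pi := by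
  constructor
  · rw [← C.θ_zero]
    exact C.monotoneOn_θ C.zero_mem hs hs.1
  · rw [← C.θ_len]
    exact C.monotoneOn_θ hs C.len_mem hs.2

theorem hasDerivAt_Γ {s : ℝ} (hs : s ∈ Ioo 0 C.len) : HasDerivAt C.Γ (dir (C.θ s)) s :=
  (C.hasDerivWithinAt_Γ s (Ioo_subset_Icc_self hs)).hasDerivAt (Icc_mem_nhds hs.1 hs.2)

theorem hasDerivAt_Γ_fst {s : ℝ} (hs : s ∈ Ioo 0 C.len) :
    HasDerivAt (fun u => (C.Γ u).1) (Real.cos (C.θ s)) s := (hasDerivAt_Γ hs).fst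

theorem hasDerivAt_Γ_snd {s : ℝ} (hs : s ∈ Ioo 0 C.len) :
    HasDerivAt (fun u => (C.Γ u).2) (Real.sin (C.θ s)) s := (hasDerivAt_Γ hs).snd

theorem contDiffAt_Γ {s : ℝ} (hs : s ∈ Ioo 0 C.len) : ContDiffAt ℝ 4 C.Γ s :=
  (C.contDiffOn_Γ.contDiffAt (Icc_mem_nhds hs.1 hs.2)).of_le (by norm_num)

theorem contDiffAt_θ {s : ℝ} (hs : s ∈ Ioo 0 C.len) : ContDiffAt ℝ 4 C.θ s :=
  C.contDiffOn_θ.contDiffAt (Icc_mem_nhds hs.1 hs.2)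

/-- Mean value theorem for the coordinate of `Γ` normal to the direction `ω`. The geometric facts
about the arc below all reduce to the sign of this sine. -/
theorem exists_slope_eq {s s' : ℝ} (hs : s ∈ Icc 0 C.len) (hs' : s' ∈ Icc 0 C.len) (h : s < s')
    (ω : ℝ) : ∃ u ∈ Ioo s s', dot (C.Γ s') (perp (dir ω)) - dot (C.Γ s) (perp (dir ω)) =
      Real.sin (C.θ u - ω) * (s' - s) := by
  have hsub : Icc s s' ⊆ Icc 0 C.len := Icc_subset_Icc hs.1 hs'.2
  have hc := C.contDiffOn_Γ.continuousOn.mono hsub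
  obtain ⟨u, hu, hslope⟩ := exists_hasDerivAt_eq_slope
    (fun u => (C.Γ u).2 * Real.cos ω - (C.Γ u).1 * Real.sin ω)
    (fun u => Real.sin (C.θ u) * Real.cos ω - Real.cos (C.θ u) * Real.sin ω) h
    ((hc.snd.mul continuousOn_const).sub (hc.fst.mul continuousOn_const))
    (fun u hu => ((hasDerivAt_Γ_snd ⟨hs.1.trans_lt hu.1, hu.2.trans_le hs'.2⟩).mul_const _).sub
      ((hasDerivAt_Γ_fst ⟨hs.1.trans_lt hu.1, hu.2.trans_le hs'.2⟩).mul_const _))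
  refine ⟨u, hu, ?_⟩
  rw [Real.sin_sub, hslope, div_mul_cancel₀ _ (by linarith), dot_perp_dir, dot_perp_dir]

theorem Γ_len : C.Γ C.len = ((C.Γ 0).1, -(C.Γ 0).2) := by
  simpa using C.symmetric 0 C.zero_mem

theorem Γ_zero_eq : C.Γ 0 = (0, -(C.width / 2)) := by
  ext
  · exact C.Γ_zero_fst
  · simp only [width, Γ_len]
    ring

theorem Γ_len_eq : C.Γ C.len = (0, C.width / 2) := by
  rw [Γ_len, Γ_zero_eq, neg_neg]

/-- Differentiating the symmetry of the first component determines the cosine, which is injective on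
`[0, π]`. -/
theorem θ_len_sub {s : ℝ} (hs : s ∈ Icc 0 C.len) : C.θ (C.len - s) = Real.pi - C.θ s := by
  rcases hs.1.eq_or_lt with h | h
  · rw [← h, sub_zero, C.θ_len, C.θ_zero, sub_zero]
  rcases hs.2.eq_or_lt with h' | h'
  · rw [h', sub_self, C.θ_len, C.θ_zero, sub_self]
  have hs0 : s ∈ Ioo 0 C.len := ⟨h, h'⟩
  have hs1 : C.len - s ∈ Ioo 0 C.len := ⟨by linarith, by linarith⟩
  have h1 : HasDerivAt (fun u => (C.Γ (C.len - u)).1) (-Real.cos (C.θ (C.len - s))) s := by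
    have := (hasDerivAt_Γ_fst hs1).scomp s ((hasDerivAt_id s).const_sub C.len)
    rw [neg_one_smul] at this
    exact this
  have h2 : HasDerivAt (fun u => (C.Γ (C.len - u)).1) (Real.cos (C.θ s)) s := by
    refine (hasDerivAt_Γ_fst hs0).congr_of_eventuallyEq ?_
    filter_upwards [Icc_mem_nhds h h'] with u hu
    rw [C.symmetric u hu]
  have h3 : Real.cos (C.θ (C.len - s)) = Real.cos (Real.pi - C.θ s) := by
    rw [Real.cos_pi_sub, ← h1.unique h2, neg_neg]
  have m := θ_mem hs
  exact Real.injOn_cos (θ_mem (len_sub_mem hs)) ⟨by linarith [m.2], by linarith [m.1]⟩ h3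

/-- A negative value would force `cos θ < 0` somewhere before `s` and `cos θ > 0` somewhere after
it, whereas `cos θ` decreases along the arc. -/
theorem Γ_fst_nonneg {s : ℝ} (hs : s ∈ Icc 0 C.len) : 0 ≤ (C.Γ s).1 := by
  by_contra! hneg
  have h0 : 0 < s := hs.1.lt_of_ne fun h => by
    rw [← h, C.Γ_zero_fst] at hneg
    exact lt_irrefl _ hneg
  have h1 : s < C.len := hs.2.lt_of_ne fun h => by
    rw [h, Γ_len_eq] at hneg
    exact lt_irrefl _ hneg
  -- For the direction `-π / 2` the normal coordinate is the first component of `Γ`.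
  obtain ⟨u, hu, h2⟩ := exists_slope_eq C.zero_mem hs h0 (-(Real.pi / 2))
  obtain ⟨v, hv, h3⟩ := exists_slope_eq hs C.len_mem h1 (-(Real.pi / 2))
  rw [sub_neg_eq_add, Real.sin_add_pi_div_two, dot_perp_dir, dot_perp_dir] at h2 h3
  simp only [Γ_zero_eq, Γ_len_eq, Real.cos_neg, Real.sin_neg, Real.cos_pi_div_two,
    Real.sin_pi_div_two] at h2 h3
  have hu' : u ∈ Icc 0 C.len := ⟨hu.1.le, hu.2.le.trans hs.2⟩
  have hv' : v ∈ Icc 0 C.len := ⟨hs.1.trans hv.1.le, hv.2.le⟩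
  have h4 := Real.antitoneOn_cos (θ_mem hu') (θ_mem hv') (C.monotoneOn_θ hu' hv' (hu.2.trans hv.1).le)
  have h5 : Real.cos (C.θ u) < 0 := by
    by_contra! h
    nlinarith [mul_nonneg h h0.le]
  have h6 : 0 < Real.cos (C.θ v) := by
    by_contra! h
    nlinarith [mul_nonpos_of_nonpos_of_nonneg h (sub_pos.2 h1).le]
  linarith

/-- Convexity: as `θ` is monotone with total turning `π`, the arc lies on the inner side of each of
its tangents. -/
theorem support_nonneg {u w : ℝ} (hu : u ∈ Icc 0 C.len) (hw : w ∈ Icc 0 C.len) :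
    0 ≤ dot (C.Γ w) (perp (dir (C.θ u))) - dot (C.Γ u) (perp (dir (C.θ u))) := by
  rcases lt_trichotomy u w with h | h | h
  · obtain ⟨ξ, hξ, h1⟩ := exists_slope_eq hu hw h (C.θ u)
    have hξ' : ξ ∈ Icc 0 C.len := ⟨hu.1.trans hξ.1.le, hξ.2.le.trans hw.2⟩
    rw [h1]
    refine mul_nonneg (Real.sin_nonneg_of_nonneg_of_le_pi ?_ ?_) (by linarith)
    · linarith [C.monotoneOn_θ hu hξ' hξ.1.le]
    · linarith [(θ_mem hu).1, (θ_mem hξ').2]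
  · rw [h, sub_self]
  · obtain ⟨ξ, hξ, h1⟩ := exists_slope_eq hw hu h (C.θ u)
    have hξ' : ξ ∈ Icc 0 C.len := ⟨hw.1.trans hξ.1.le, hξ.2.le.trans hu.2⟩
    rw [← neg_sub, h1, neg_nonneg]
    refine mul_nonpos_of_nonpos_of_nonneg (Real.sin_nonpos_of_nonpos_of_neg_pi_le ?_ ?_)
      (by linarith)
    · linarith [C.monotoneOn_θ hξ' hu hξ.2.le]
    · linarith [(θ_mem hu).2, (θ_mem hξ').1]

/-! ## Hitting points -/

/-- Between two hits the mean value theorem yields a zero of `sin (θ - ω)`. But this sine is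
positive at both hits, and `θ` varies by at most `π` between them. -/
theorem IsHit.le {z : ℝ × ℝ} {s s' : ℝ} (h : C.IsHit z s) (h' : C.IsHit z s') : s' ≤ s := by
  by_contra! hlt
  obtain ⟨hs, hc, hn⟩ := h
  obtain ⟨hs', hc', hn'⟩ := h'
  have hs := Ioo_subset_Icc_self hs
  have hs' := Ioo_subset_Icc_self hs'
  obtain ⟨u, hu, h1⟩ := exists_slope_eq hs hs' hlt z.2
  have hu' : u ∈ Icc 0 C.len := ⟨hs.1.trans hu.1.le, hu.2.le.trans hs'.2⟩
  rw [hc, hc', sub_self] at h1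
  have e1 : 0 < Real.sin (C.θ s - z.2) := by rw [← neg_sub, Real.sin_neg]; linarith
  have e2 : 0 < Real.sin (C.θ s' - z.2) := by rw [← neg_sub, Real.sin_neg]; linarith
  have h2 : 0 < Real.sin (C.θ u - z.2) := sin_pos_of_mem_Icc
    ⟨by linarith [C.monotoneOn_θ hs hu' hu.1.le], by linarith [C.monotoneOn_θ hu' hs' hu.2.le]⟩
    (by linarith [(θ_mem hs).1, (θ_mem hs').2]) e1 e2
  exact (mul_pos h2 (sub_pos.2 hlt)).ne h1

theorem IsHit.eq {z : ℝ × ℝ} {s s' : ℝ} (h : C.IsHit z s) (h' : C.IsHit z s') : s = s' :=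
  le_antisymm (h'.le h) (h.le h')

theorem IsHit.hit_eq {z : ℝ × ℝ} {s : ℝ} (h : C.IsHit z s) : C.hit z = s :=
  IsHit.eq (Classical.epsilon_spec ⟨s, h⟩ : C.IsHit z (C.hit z)) h

theorem IsHit.reflectLine_eq {z : ℝ × ℝ} {s : ℝ} (h : C.IsHit z s) :
    C.reflectLine z = (dot (C.Γ s) (perp (dir (2 * C.θ s - z.2))), 2 * C.θ s - z.2) := by
  rw [reflectLine, h.hit_eq]

end CurvedComponent

namespace CurvedComponent

variable {C : CurvedComponent}

/-! ## Smoothness of the reflection -/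

theorem contDiffAt_dot_perp {s : ℝ} (hs : s ∈ Ioo 0 C.len) (ω : ℝ) :
    ContDiffAt ℝ 4 (fun q : ℝ × ℝ => dot (C.Γ q.1) (perp (dir q.2))) (s, ω) := by
  have h : ContDiffAt ℝ 4 (fun q : ℝ × ℝ => C.Γ q.1) (s, ω) :=
    ContDiffAt.comp (s, ω) (contDiffAt_Γ hs) contDiffAt_fst
  simp only [dot_perp_dir]
  exact (h.snd.mul (Real.contDiff_cos.contDiffAt.comp _ contDiffAt_snd)).sub
    (h.fst.mul (Real.contDiff_sin.contDiffAt.comp _ contDiffAt_snd))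

theorem hasFDerivAt_dot_perp {s : ℝ} (hs : s ∈ Ioo 0 C.len) (ω : ℝ) :
    HasFDerivAt (fun q : ℝ × ℝ => dot (C.Γ q.1) (perp (dir q.2)))
      (Real.sin (C.θ s - ω) • ContinuousLinearMap.fst ℝ ℝ ℝ
        - dot (C.Γ s) (dir ω) • ContinuousLinearMap.snd ℝ ℝ ℝ) (s, ω) := by
  have h1 : HasFDerivAt (fun q : ℝ × ℝ => (C.Γ q.1).1)
      (Real.cos (C.θ s) • ContinuousLinearMap.fst ℝ ℝ ℝ) (s, ω) :=
    HasDerivAt.comp_hasFDerivAt (h₂ := fun u => (C.Γ u).1) (s, ω) (hasDerivAt_Γ_fst hs)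
      hasFDerivAt_fst
  have h2 : HasFDerivAt (fun q : ℝ × ℝ => (C.Γ q.1).2)
      (Real.sin (C.θ s) • ContinuousLinearMap.fst ℝ ℝ ℝ) (s, ω) :=
    HasDerivAt.comp_hasFDerivAt (h₂ := fun u => (C.Γ u).2) (s, ω) (hasDerivAt_Γ_snd hs)
      hasFDerivAt_fst
  have h3 : HasFDerivAt (fun q : ℝ × ℝ => Real.cos q.2)
      ((-Real.sin ω) • ContinuousLinearMap.snd ℝ ℝ ℝ) (s, ω) :=
    HasDerivAt.comp_hasFDerivAt (h₂ := Real.cos) (s, ω) (Real.hasDerivAt_cos ω) hasFDerivAt_snd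
  have h4 : HasFDerivAt (fun q : ℝ × ℝ => Real.sin q.2)
      (Real.cos ω • ContinuousLinearMap.snd ℝ ℝ ℝ) (s, ω) :=
    HasDerivAt.comp_hasFDerivAt (h₂ := Real.sin) (s, ω) (Real.hasDerivAt_sin ω) hasFDerivAt_snd
  simp only [dot_perp_dir]
  refine ((h2.mul h3).sub (h1.mul h4)).congr_fderiv ?_
  ext <;> simp [dot, dir, Real.sin_sub] <;> ring

theorem eventually_isHit_of_mem {s ω : ℝ} (hs : s ∈ Ioo 0 C.len)
    (hn : Real.sin (ω - C.θ s) < 0) :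
    ∀ᶠ q : ℝ × ℝ in 𝓝 (s, ω), C.IsHit (dot (C.Γ q.1) (perp (dir q.2)), q.2) q.1 := by
  have h1 : ∀ᶠ q : ℝ × ℝ in 𝓝 (s, ω), q.1 ∈ Ioo 0 C.len :=
    continuousAt_fst.eventually (isOpen_Ioo.mem_nhds hs)
  have h2 : ContinuousAt (fun q : ℝ × ℝ => Real.sin (q.2 - C.θ q.1)) (s, ω) := by
    have : ContinuousAt (fun q : ℝ × ℝ => C.θ q.1) (s, ω) :=
      ContinuousAt.comp (contDiffAt_θ hs).continuousAt continuousAt_fst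
    exact Real.continuous_sin.continuousAt.comp (continuousAt_snd.sub this)
  filter_upwards [h1, h2.eventually (gt_mem_nhds hn)] with q hq1 hq2
  exact ⟨hq1, rfl, hq2⟩

/-- Transversality is exactly the nondegeneracy needed to solve for the parameter. The resulting
smooth branch consists of hits, so by uniqueness it agrees with the chosen value `hit`. -/
theorem IsHit.contDiffAt_hit {z : ℝ × ℝ} {s : ℝ} (h : C.IsHit z s) :
    ContDiffAt ℝ 4 C.hit z ∧ ∀ᶠ w in 𝓝 z, C.IsHit w (C.hit w) := by
  obtain ⟨hs, hc, hn⟩ := h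
  have hne : Real.sin (C.θ s - z.2) ≠ 0 := by
    rw [← neg_sub, Real.sin_neg]
    exact neg_ne_zero.2 hn.ne
  obtain ⟨σ, hσ, hσ0, hσ1, -⟩ := exists_local_inverse (contDiffAt_dot_perp hs z.2) (by
    rw [(hasFDerivAt_dot_perp hs z.2).fderiv]
    simpa using hne)
  simp only [hc] at hσ hσ0 hσ1
  have hev : ∀ᶠ w in 𝓝 z, C.IsHit w (σ w) := by
    have hc2 : ContinuousAt (fun w : ℝ × ℝ => (σ w, w.2)) z :=
      hσ.continuousAt.prodMk continuousAt_snd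
    have ht : Tendsto (fun w : ℝ × ℝ => (σ w, w.2)) (𝓝 z) (𝓝 (s, z.2)) := by
      have := hc2.tendsto
      rwa [show σ z = s from hσ0] at this
    filter_upwards [hσ1, ht.eventually (eventually_isHit_of_mem hs hn)] with w h1 h2
    rw [h1] at h2
    exact h2
  refine ⟨hσ.congr_of_eventuallyEq ?_, ?_⟩
  · filter_upwards [hev] with w hw
    exact hw.hit_eq
  · filter_upwards [hev] with w hw
    rwa [hw.hit_eq]

theorem IsHit.contDiffAt_reflectLine {z : ℝ × ℝ} {s : ℝ} (h : C.IsHit z s) :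
    ContDiffAt ℝ 4 C.reflectLine z := by
  have h1 := h.contDiffAt_hit.1
  have hs : C.hit z ∈ Ioo 0 C.len := by rw [h.hit_eq]; exact h.1
  have h2 : ContDiffAt ℝ 4 (fun w => 2 * C.θ (C.hit w) - w.2) z :=
    (contDiffAt_const.mul (ContDiffAt.comp z (contDiffAt_θ hs) h1)).sub contDiffAt_snd
  have h3 : ContDiffAt ℝ 4 (fun w => (C.hit w, 2 * C.θ (C.hit w) - w.2)) z := h1.prodMk h2
  exact (ContDiffAt.comp z (contDiffAt_dot_perp hs _) h3).prodMk h2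

/-- In the coordinates `(s, ω)` the area form on lines is `sin (θ - ω) ds ∧ dω`. The reflection `ω ↦
2 θ - ω` reverses `ds ∧ dω` and also the sign of the sine, so the two signs cancel. -/
theorem IsHit.planeDet_fderiv_reflectLine {z : ℝ × ℝ} {s : ℝ} (h : C.IsHit z s) :
    planeDet (fderiv ℝ C.reflectLine z) = 1 := by
  have hr := (h.contDiffAt_reflectLine.differentiableAt (by norm_num)).hasFDerivAt
  obtain ⟨hs, hc, hn⟩ := h
  set ω := z.2
  set φ : ℝ × ℝ → ℝ × ℝ := fun q => (dot (C.Γ q.1) (perp (dir q.2)), q.2) with hφ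
  have hφz : φ (s, ω) = z := Prod.ext hc rfl
  have hφ' := (hasFDerivAt_dot_perp hs ω).prodMk (hasFDerivAt_snd (𝕜 := ℝ) (p := (s, ω)))
  change HasFDerivAt φ _ _ at hφ'
  have hcomp := HasFDerivAt.comp (s, ω) (g := C.reflectLine) (by rw [hφz]; exact hr) hφ'
  have hθ : HasDerivAt C.θ (deriv C.θ s) s :=
    ((contDiffAt_θ hs).differentiableAt (by norm_num)).hasDerivAt
  have hθ1 : HasFDerivAt (fun q : ℝ × ℝ => C.θ q.1)
      (deriv C.θ s • ContinuousLinearMap.fst ℝ ℝ ℝ) (s, ω) :=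
    HasDerivAt.comp_hasFDerivAt (s, ω) hθ hasFDerivAt_fst
  have hα : HasFDerivAt (fun q : ℝ × ℝ => 2 * C.θ q.1 - q.2) _ (s, ω) :=
    (hθ1.const_mul 2).sub (hasFDerivAt_snd (𝕜 := ℝ) (p := (s, ω)))
  have hpair := (hasFDerivAt_fst (𝕜 := ℝ) (p := (s, ω))).prodMk hα
  have hψ1 := HasFDerivAt.comp (s, ω) (hasFDerivAt_dot_perp hs (2 * C.θ s - ω)) hpair
  have hψ := hψ1.prodMk hα
  have heq : C.reflectLine ∘ φ =ᶠ[𝓝 (s, ω)] fun q =>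
      (dot (C.Γ q.1) (perp (dir (2 * C.θ q.1 - q.2))), 2 * C.θ q.1 - q.2) := by
    filter_upwards [eventually_isHit_of_mem hs hn] with q hq
    exact hq.reflectLine_eq
  have huniq := hcomp.unique (hψ.congr_of_eventuallyEq heq)
  have hdet := congrArg planeDet huniq
  rw [planeDet_comp] at hdet
  have e1 : Real.sin (C.θ s - (2 * C.θ s - ω)) = -Real.sin (C.θ s - ω) := by
    rw [← Real.sin_neg]; ring_nf
  simp only [planeDet, ContinuousLinearMap.prod_apply, ContinuousLinearMap.comp_apply,
    sub_apply, smul_apply,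
    ContinuousLinearMap.coe_fst', ContinuousLinearMap.coe_snd', smul_eq_mul, e1] at hdet
  have hne : Real.sin (C.θ s - ω) ≠ 0 := by
    rw [← neg_sub, Real.sin_neg]
    exact neg_ne_zero.2 hn.ne
  simp only [planeDet]
  refine mul_right_cancel₀ hne ?_
  linarith

/-! ## Time reversal and periodicity in the angle -/

/-- Time reversal of an oriented line, combined with the reflection in the horizontal axis. -/
noncomputable def reverse (z : ℝ × ℝ) : ℝ × ℝ := (z.1, Real.pi - z.2)

theorem dot_symm_perp_dir (p : ℝ × ℝ) (ω : ℝ) :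
    dot (p.1, -p.2) (perp (dir (Real.pi - ω))) = dot p (perp (dir ω)) := by
  rw [dot_perp_dir, dot_perp_dir, Real.cos_pi_sub, Real.sin_pi_sub]
  ring

/-- The reversed and mirrored outgoing line hits `Γ` at the mirror parameter `len - s`, where the
tangent angle is `π - θ s`. -/
theorem IsHit.reverse_reflectLine {z : ℝ × ℝ} {s : ℝ} (h : C.IsHit z s) :
    C.reflectLine (reverse (C.reflectLine z)) = reverse z := by
  have hr := h.reflectLine_eq
  obtain ⟨hs, hc, hn⟩ := h
  have hs' := Ioo_subset_Icc_self hs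
  have hit : C.IsHit (reverse (C.reflectLine z)) (C.len - s) := by
    refine ⟨⟨by linarith [hs.2], by linarith [hs.1]⟩, ?_, ?_⟩
    · rw [hr, C.symmetric s hs']
      exact dot_symm_perp_dir _ _
    · rw [hr, θ_len_sub hs']
      simp only [reverse]
      convert hn using 2
      ring
  rw [hit.reflectLine_eq, hr, θ_len_sub hs', C.symmetric s hs']
  have e : 2 * (Real.pi - C.θ s) - (Real.pi - (2 * C.θ s - z.2)) = Real.pi - z.2 := by ring
  simp only [reverse]
  rw [e, dot_symm_perp_dir, hc]

theorem isHit_add_two_pi (z : ℝ × ℝ) (m : ℤ) :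
    C.IsHit (z + (0, 2 * Real.pi * m)) = C.IsHit z := by
  funext s
  have h : Real.sin (z.2 + 2 * Real.pi * m - C.θ s) = Real.sin (z.2 - C.θ s) := by
    rw [show z.2 + 2 * Real.pi * m - C.θ s = z.2 - C.θ s + m * (2 * Real.pi) by ring,
      Real.sin_add_int_mul_two_pi]
  simp only [IsHit, Prod.snd_add, Prod.fst_add, dir_add_int_mul_two_pi, add_zero, h]

theorem reflectLine_add_two_pi (z : ℝ × ℝ) (m : ℤ) :
    C.reflectLine (z + (0, 2 * Real.pi * m)) =
      C.reflectLine z + (0, 2 * Real.pi * (-m : ℤ)) := by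
  have h : C.hit (z + (0, 2 * Real.pi * m)) = C.hit z := by
    rw [hit, isHit_add_two_pi, hit]
  have e : 2 * C.θ (C.hit z) - (z.2 + 2 * Real.pi * m) =
      2 * C.θ (C.hit z) - z.2 + 2 * Real.pi * (-m : ℤ) := by
    push_cast
    ring
  simp only [reflectLine, h, Prod.snd_add, e, dir_add_int_mul_two_pi, Prod.mk_add_mk, add_zero]

/-- Angles are real numbers, while the final direction is prescribed only modulo `2π`. The shift
changes sign at each reflection and does not depend on the line. -/
theorem exists_iterate_reflectLine_add (N : ℕ) (m : ℤ) :
    ∃ m' : ℤ, ∀ z, C.reflectLine^[N] (z + (0, 2 * Real.pi * m)) =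
      C.reflectLine^[N] z + (0, 2 * Real.pi * m') := by
  induction N generalizing m with
  | zero => exact ⟨m, fun z => rfl⟩
  | succ N ih =>
    obtain ⟨m', h⟩ := ih (-m)
    refine ⟨m', fun z => ?_⟩
    rw [Function.iterate_succ_apply, reflectLine_add_two_pi, h, Function.iterate_succ_apply]

/-! ## Sequences of reflections -/

/-- The oriented line `z` is reflected off `Γ` at least `N` times in a row. -/
def HitsTimes (C : CurvedComponent) (N : ℕ) (z : ℝ × ℝ) : Prop :=
  ∀ k < N, C.IsHit (C.reflectLine^[k] z) (C.hit (C.reflectLine^[k] z))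

theorem HitsTimes.mono {N k : ℕ} {z : ℝ × ℝ} (h : C.HitsTimes N z) (hk : k ≤ N) :
    C.HitsTimes k z := fun i hi => h i (hi.trans_le hk)

theorem HitsTimes.tail {N : ℕ} {z : ℝ × ℝ} (h : C.HitsTimes (N + 1) z) :
    C.HitsTimes N (C.reflectLine z) := fun k hk => h (k + 1) (by lia)

theorem HitsTimes.contDiffAt {N : ℕ} {z : ℝ × ℝ} (h : C.HitsTimes N z) :
    ContDiffAt ℝ 4 (C.reflectLine^[N]) z := by
  induction N generalizing z with
  | zero => exact contDiffAt_id
  | succ N ih =>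
    exact ContDiffAt.comp z (ih h.tail) (h 0 N.succ_pos).contDiffAt_reflectLine

theorem HitsTimes.planeDet_fderiv {N : ℕ} {z : ℝ × ℝ} (h : C.HitsTimes N z) :
    planeDet (fderiv ℝ (C.reflectLine^[N]) z) = 1 := by
  induction N generalizing z with
  | zero => simp [planeDet]
  | succ N ih =>
    rw [Function.iterate_succ, fderiv_comp z (h.tail.contDiffAt.differentiableAt (by norm_num))
      ((h 0 N.succ_pos).contDiffAt_reflectLine.differentiableAt (by norm_num)), planeDet_comp,
      ih h.tail, (show C.IsHit z _ from h 0 N.succ_pos).planeDet_fderiv_reflectLine, one_mul]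

theorem HitsTimes.eventually {N : ℕ} {z : ℝ × ℝ} (h : C.HitsTimes N z) :
    ∀ᶠ w in 𝓝 z, C.HitsTimes N w := by
  have : ∀ k ∈ Finset.range N, ∀ᶠ w in 𝓝 z,
      C.IsHit (C.reflectLine^[k] w) (C.hit (C.reflectLine^[k] w)) := fun k hk => by
    have hk := Finset.mem_range.1 hk
    exact (h.mono hk.le).contDiffAt.continuousAt.eventually (h k hk).contDiffAt_hit.2
  filter_upwards [(Finset.eventually_all _).2 this] with w hw k hk
  exact hw k (Finset.mem_range.2 hk)

theorem HitsTimes.reverse_iterate {N : ℕ} {z : ℝ × ℝ} (h : C.HitsTimes N z) :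
    C.reflectLine^[N] (reverse (C.reflectLine^[N] z)) = reverse z := by
  induction N generalizing z with
  | zero => rfl
  | succ N ih =>
    rw [Function.iterate_succ_apply', Function.iterate_succ_apply, ih h.tail]
    exact (show C.IsHit z _ from h 0 N.succ_pos).reverse_reflectLine

end CurvedComponent

/-! ## The billiard map along the reference sequence -/

theorem planeDet_fderiv_shear {g : ℝ → ℝ} {p : ℝ × ℝ} (hg : DifferentiableAt ℝ g p.2) (k : ℝ) :
    planeDet (fderiv ℝ (fun q : ℝ × ℝ => (q.1 + g q.2, q.2 + k)) p) = 1 := by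
  have h1 : HasFDerivAt (fun q : ℝ × ℝ => g q.2) (deriv g p.2 • ContinuousLinearMap.snd ℝ ℝ ℝ) p :=
    HasDerivAt.comp_hasFDerivAt p hg.hasDerivAt hasFDerivAt_snd
  have h2 := ((hasFDerivAt_fst (𝕜 := ℝ) (p := p)).add h1).prodMk
    ((hasFDerivAt_snd (𝕜 := ℝ) (p := p)).add_const k)
  have h3 : fderiv ℝ (fun q : ℝ × ℝ => (q.1 + g q.2, q.2 + k)) p = _ := HasFDerivAt.fderiv h2
  rw [h3]
  simp [planeDet]

namespace CompleteSymmetricSequence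

open CurvedComponent

variable {C : CurvedComponent} (O : CompleteSymmetricSequence C)

theorem contDiff_dot_perp (p : ℝ × ℝ) : ContDiff ℝ 4 fun ω : ℝ => dot p (perp (dir ω)) := by
  simp only [dot_perp_dir]
  fun_prop

theorem iterate_inLine_zero {k : ℕ} (hk : k ≤ O.last) :
    C.reflectLine^[k] (O.inLine 0) = (dot (C.Γ (O.s k)) (perp (dir (O.ω k))), O.ω k) ∧
      C.IsHit (C.reflectLine^[k] (O.inLine 0)) (O.s k) := by
  suffices h : C.reflectLine^[k] (O.inLine 0) =
      (dot (C.Γ (O.s k)) (perp (dir (O.ω k))), O.ω k) from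
    ⟨h, by rw [h]; exact ⟨O.s_mem k hk, rfl, O.incoming k hk⟩⟩
  induction k with
  | zero => simp [inLine]
  | succ k ih =>
    have hk' : k ≤ O.last := by lia
    have hh : C.IsHit (dot (C.Γ (O.s k)) (perp (dir (O.ω k))), O.ω k) (O.s k) :=
      ⟨O.s_mem k hk', rfl, O.incoming k hk'⟩
    obtain ⟨τ, -, hτ⟩ := O.flight k hk
    rw [Function.iterate_succ_apply', ih hk', hh.reflectLine_eq, ← O.reflection k hk', hτ]
    ext
    · simp only [dot_perp_dir]
      simp only [dir, Prod.fst_add, Prod.snd_add, Prod.smul_fst, Prod.smul_snd,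
        smul_eq_mul]
      ring
    · rfl

theorem hitsTimes_inLine_zero : C.HitsTimes (O.last + 1) (O.inLine 0) := fun k hk => by
  have h := (O.iterate_inLine_zero (Nat.lt_succ_iff.1 hk)).2
  rwa [h.hit_eq]

theorem iterate_inLine_zero_last : C.reflectLine^[O.last + 1] (O.inLine 0) =
    (dot (C.Γ (O.s O.last)) (perp (dir (O.ω (O.last + 1)))), O.ω (O.last + 1)) := by
  obtain ⟨h, hh⟩ := O.iterate_inLine_zero le_rfl
  rw [Function.iterate_succ_apply', hh.reflectLine_eq, h, ← O.reflection _ le_rfl]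

theorem F_zero : O.F 0 = 0 := by
  rw [F, iterate_inLine_zero_last]
  simp

theorem contDiff_inLine : ContDiff ℝ 4 O.inLine := by
  refine (contDiff_fst.add ((contDiff_dot_perp _).comp (contDiff_const.add contDiff_snd))).prodMk
    (contDiff_const.add contDiff_snd)

/-- The local coordinates of an outgoing line. -/
noncomputable def outCoord (z : ℝ × ℝ) : ℝ × ℝ :=
  (z.1 - dot (C.Γ (O.s O.last)) (perp (dir z.2)), z.2 - O.ω (O.last + 1))

theorem contDiff_outCoord : ContDiff ℝ 4 O.outCoord := by
  refine (contDiff_fst.sub ((contDiff_dot_perp _).comp contDiff_snd)).prodMk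
    (contDiff_snd.sub contDiff_const)

theorem F_eq_comp : O.F = O.outCoord ∘ C.reflectLine^[O.last + 1] ∘ O.inLine := rfl

theorem eventually_hitsTimes : ∀ᶠ q in 𝓝 (0 : ℝ × ℝ), C.HitsTimes (O.last + 1) (O.inLine q) :=
  O.contDiff_inLine.continuous.continuousAt.eventually O.hitsTimes_inLine_zero.eventually

theorem contDiffAt_F {q : ℝ × ℝ} (h : C.HitsTimes (O.last + 1) (O.inLine q)) :
    ContDiffAt ℝ 4 O.F q :=
  O.contDiff_outCoord.contDiffAt.comp q (h.contDiffAt.comp q O.contDiff_inLine.contDiffAt)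

/-- Both coordinate changes are shears followed by translations, so the determinant is that of the
iterated reflection. -/
theorem planeDet_fderiv_F {q : ℝ × ℝ} (h : C.HitsTimes (O.last + 1) (O.inLine q)) :
    planeDet (fderiv ℝ O.F q) = 1 := by
  have d1 : DifferentiableAt ℝ O.inLine q := O.contDiff_inLine.differentiable (by norm_num) q
  have d2 := h.contDiffAt.differentiableAt (by norm_num)
  have d3 := fun z => O.contDiff_outCoord.differentiable (by norm_num) z
  rw [F_eq_comp, fderiv_comp q (d3 _) (d2.comp q d1), fderiv_comp q d2 d1, planeDet_comp,
    planeDet_comp, h.planeDet_fderiv]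
  have e1 : O.inLine = fun q : ℝ × ℝ =>
      (q.1 + (fun y => dot (C.Γ (O.s 0)) (perp (dir (O.ω 0 + y)))) q.2, q.2 + O.ω 0) := by
    funext q
    simp only [inLine, add_comm q.2]
  have e2 : O.outCoord = fun q : ℝ × ℝ =>
      (q.1 + (fun y => -dot (C.Γ (O.s O.last)) (perp (dir y))) q.2,
        q.2 + -O.ω (O.last + 1)) := by
    funext q
    simp only [outCoord, sub_eq_add_neg]
  have i1 : planeDet (fderiv ℝ O.inLine q) = 1 := by
    rw [e1]
    refine planeDet_fderiv_shear (g := fun y => dot (C.Γ (O.s 0)) (perp (dir (O.ω 0 + y)))) ?_ _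
    exact ((contDiff_dot_perp _).comp (contDiff_const.add contDiff_id)).differentiable
      (by norm_num) _
  have i2 : ∀ z, planeDet (fderiv ℝ O.outCoord z) = 1 := fun z => by
    rw [e2]
    refine planeDet_fderiv_shear (g := fun y => -dot (C.Γ (O.s O.last)) (perp (dir y))) ?_ _
    exact (contDiff_dot_perp _).neg.differentiable (by norm_num) _
  rw [i1, i2]
  norm_num

theorem Γ_last : C.Γ (O.s O.last) = ((C.Γ (O.s 0)).1, -(C.Γ (O.s 0)).2) := by
  have h := O.symmetric 0 (Nat.zero_le _)
  rw [Nat.sub_zero] at h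
  rw [h, C.symmetric _ (Ioo_subset_Icc_self (O.s_mem 0 (Nat.zero_le _)))]

theorem dot_Γ_last (ω : ℝ) : dot (C.Γ (O.s O.last)) (perp (dir (Real.pi - ω))) =
    dot (C.Γ (O.s 0)) (perp (dir ω)) := by
  rw [Γ_last, dot_symm_perp_dir]

theorem dot_Γ_first (ω : ℝ) : dot (C.Γ (O.s 0)) (perp (dir (Real.pi - ω))) =
    dot (C.Γ (O.s O.last)) (perp (dir ω)) := by
  rw [← dot_Γ_last, sub_sub_cancel]

theorem exists_F_reverse : ∃ m : ℤ, ∀ q, C.HitsTimes (O.last + 1) (O.inLine q) →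
    O.F ((O.F q).1, -(O.F q).2) = (q.1, -q.2 + 2 * Real.pi * m) := by
  obtain ⟨j, hj⟩ := O.angle_out
  obtain ⟨m', hm'⟩ := exists_iterate_reflectLine_add (C := C) (O.last + 1) (j + 1)
  -- Here `m'` is the shift left by the iteration; `-1 - j` arises because `outCoord` subtracts `3π
  -- - ω 0 + 2πj` from an angle based at `π - ω 0`.
  refine ⟨m' - 1 - j, fun q hq => ?_⟩
  have hrev := hq.reverse_iterate
  set w := C.reflectLine^[O.last + 1] (O.inLine q) with hw
  have hF : O.F q = O.outCoord w := rfl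
  have e1 : O.inLine ((O.F q).1, -(O.F q).2) =
      reverse w + (0, 2 * Real.pi * (j + 1 : ℤ)) := by
    rw [hF]
    have e : O.ω 0 + -(w.2 - O.ω (O.last + 1)) =
        Real.pi - w.2 + 2 * Real.pi * (j + 1 : ℤ) := by
      rw [hj]; push_cast; ring
    simp only [inLine, outCoord, reverse]
    rw [e, dir_add_int_mul_two_pi, dot_Γ_first]
    simp
  have e2 : O.F ((O.F q).1, -(O.F q).2) =
      O.outCoord (C.reflectLine^[O.last + 1] (O.inLine ((O.F q).1, -(O.F q).2))) := rfl
  rw [e2, e1, hm', hrev]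
  simp only [outCoord, reverse, inLine, Prod.mk_add_mk, add_zero, dir_add_int_mul_two_pi,
    dot_Γ_last, add_sub_cancel_right]
  rw [hj]
  ext
  · rfl
  · push_cast; ring

/-- The multiple of `2π` is the same for all `q`, and it vanishes at the fixed point `q = 0`. -/
theorem F_reverse {q : ℝ × ℝ} (hq : C.HitsTimes (O.last + 1) (O.inLine q)) :
    O.F ((O.F q).1, -(O.F q).2) = (q.1, -q.2) := by
  obtain ⟨m, hm⟩ := O.exists_F_reverse
  have h0 := hm 0 O.hitsTimes_inLine_zero
  have hz : ((O.F 0).1, -(O.F 0).2) = (0 : ℝ × ℝ) := by rw [F_zero]; simp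
  rw [hz, F_zero] at h0
  have h1 : 2 * Real.pi * (m : ℝ) = 0 := by
    have := congrArg Prod.snd h0
    simpa using this.symm
  rw [hm q hq, h1, add_zero]

end CompleteSymmetricSequence

namespace CompleteSymmetricSequence

open CurvedComponent

variable {C : CurvedComponent} (O : CompleteSymmetricSequence C)

/-! ## The Jacobian matrix of the billiard map -/

/-- The entry `∂x₁/∂x₀` of the Jacobian matrix. -/
noncomputable def jacXX (q : ℝ × ℝ) : ℝ := (fderiv ℝ O.F q (1, 0)).1

/-- The entry `∂y₁/∂x₀` of the Jacobian matrix. -/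
noncomputable def jacYX (q : ℝ × ℝ) : ℝ := (fderiv ℝ O.F q (1, 0)).2

/-- The entry `∂y₁/∂y₀` of the Jacobian matrix. -/
noncomputable def jacYY (q : ℝ × ℝ) : ℝ := (fderiv ℝ O.F q (0, 1)).2

/-- The reversed image of a point under the billiard map. -/
noncomputable def mirrorF (q : ℝ × ℝ) : ℝ × ℝ := ((O.F q).1, -(O.F q).2)

/-- The reflection `(x, y) ↦ (x, -y)` as a linear map. -/
noncomputable def conjCLM : (ℝ × ℝ) →L[ℝ] (ℝ × ℝ) :=
  (ContinuousLinearMap.fst ℝ ℝ ℝ).prod (-ContinuousLinearMap.snd ℝ ℝ ℝ)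

theorem conjCLM_apply (v : ℝ × ℝ) : conjCLM v = (v.1, -v.2) := by simp [conjCLM]

variable {O}

theorem contDiffAt_fderiv_F_apply {q : ℝ × ℝ} (h : C.HitsTimes (O.last + 1) (O.inLine q))
    (v : ℝ × ℝ) : ContDiffAt ℝ 3 (fun q => fderiv ℝ O.F q v) q :=
  ((O.contDiffAt_F h).fderiv_right (by norm_num)).clm_apply contDiffAt_const

theorem contDiffAt_jacXX {q : ℝ × ℝ} (h : C.HitsTimes (O.last + 1) (O.inLine q)) :
    ContDiffAt ℝ 3 O.jacXX q := (contDiffAt_fderiv_F_apply h _).fst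

theorem contDiffAt_jacYX {q : ℝ × ℝ} (h : C.HitsTimes (O.last + 1) (O.inLine q)) :
    ContDiffAt ℝ 3 O.jacYX q := (contDiffAt_fderiv_F_apply h _).snd

theorem contDiffAt_jacYY {q : ℝ × ℝ} (h : C.HitsTimes (O.last + 1) (O.inLine q)) :
    ContDiffAt ℝ 3 O.jacYY q := (contDiffAt_fderiv_F_apply h _).snd

theorem hasFDerivAt_F {q : ℝ × ℝ} (h : C.HitsTimes (O.last + 1) (O.inLine q)) :
    HasFDerivAt O.F (fderiv ℝ O.F q) q :=
  ((O.contDiffAt_F h).differentiableAt (by norm_num)).hasFDerivAt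

theorem hasFDerivAt_mirrorF {q : ℝ × ℝ} (h : C.HitsTimes (O.last + 1) (O.inLine q)) :
    HasFDerivAt O.mirrorF (conjCLM.comp (fderiv ℝ O.F q)) q := by
  have h1 : O.mirrorF = conjCLM ∘ O.F := by
    funext q
    rw [Function.comp_apply, conjCLM_apply, mirrorF]
  rw [h1]
  exact conjCLM.hasFDerivAt.comp q (hasFDerivAt_F h)

theorem mirrorF_zero : O.mirrorF 0 = 0 := by
  rw [mirrorF, F_zero]
  simp

theorem tendsto_mirrorF : Tendsto O.mirrorF (𝓝 0) (𝓝 0) := by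
  have := (hasFDerivAt_mirrorF O.hitsTimes_inLine_zero).continuousAt.tendsto
  rwa [mirrorF_zero] at this

/-- Differentiating `F ∘ mirrorF = S` with `S (x, y) = (x, -y)` expresses `DF` at the mirror point
through the inverse of `DF q`. As the determinant is one, this inverse has polynomial entries, and
its second row gives both identities. -/
theorem eventually_jac_mirrorF : ∀ᶠ q in 𝓝 (0 : ℝ × ℝ),
    O.jacYX (O.mirrorF q) = O.jacYX q ∧ O.jacYY (O.mirrorF q) = O.jacXX q := by
  filter_upwards [O.eventually_hitsTimes.eventually_nhds,
    tendsto_mirrorF.eventually O.eventually_hitsTimes] with q hq hq'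
  have hq0 := hq.self_of_nhds
  have h1 : HasFDerivAt (O.F ∘ O.mirrorF)
      ((fderiv ℝ O.F (O.mirrorF q)).comp (conjCLM.comp (fderiv ℝ O.F q))) q :=
    (hasFDerivAt_F hq').comp q (hasFDerivAt_mirrorF hq0)
  have h2 : O.F ∘ O.mirrorF =ᶠ[𝓝 q] conjCLM := by
    filter_upwards [hq] with p hp
    rw [conjCLM_apply]
    exact O.F_reverse hp
  have h3 := h1.unique (conjCLM.hasFDerivAt.congr_of_eventuallyEq h2)
  have hdet := O.planeDet_fderiv_F hq0
  have e1 := congrArg (fun A => (A (1, 0)).2) h3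
  have e2 := congrArg (fun A => (A (0, 1)).2) h3
  simp only [ContinuousLinearMap.comp_apply, conjCLM_apply] at e1 e2
  rw [apply_eq_smul_add_smul (fderiv ℝ O.F (O.mirrorF q))] at e1 e2
  simp only [Prod.snd_add, Prod.smul_snd, smul_eq_mul] at e1 e2
  simp only [planeDet] at hdet
  simp only [jacXX, jacYX, jacYY]
  set a := (fderiv ℝ O.F q (1, 0)).1
  set b := (fderiv ℝ O.F q (0, 1)).1
  set c := (fderiv ℝ O.F q (1, 0)).2
  set d := (fderiv ℝ O.F q (0, 1)).2
  set c' := (fderiv ℝ O.F (O.mirrorF q) (1, 0)).2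
  set d' := (fderiv ℝ O.F (O.mirrorF q) (0, 1)).2
  constructor
  · linear_combination c' * (-hdet) + d * e1 - c * e2
  · linear_combination d' * (-hdet) + b * e1 - a * e2

variable {β : ℝ}

theorem HasLinearization.fderiv_apply (h : O.HasLinearization β) (v : ℝ × ℝ) :
    fderiv ℝ O.F 0 v = (-v.1 + β * v.2, -v.2) := by
  have : fderiv ℝ O.F 0 = _ := HasFDerivAt.fderiv h
  rw [this]
  simp

theorem HasLinearization.jac_zero (h : O.HasLinearization β) :
    O.jacXX 0 = -1 ∧ O.jacYX 0 = 0 ∧ O.jacYY 0 = -1 := by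
  simp [jacXX, jacYX, jacYY, h.fderiv_apply]

/-- The derivative of `mirrorF` at the origin maps `(1, 0)` to `(-1, 0)`. -/
theorem HasLinearization.fderiv_comp_mirrorF (h : O.HasLinearization β) {g k : ℝ × ℝ → ℝ}
    (hg : DifferentiableAt ℝ g 0) (hk : ∀ᶠ q in 𝓝 (0 : ℝ × ℝ), g (O.mirrorF q) = k q) :
    fderiv ℝ k 0 (1, 0) = -fderiv ℝ g 0 (1, 0) := by
  have h0 := hasFDerivAt_mirrorF O.hitsTimes_inLine_zero
  have h1 : HasFDerivAt (g ∘ O.mirrorF) ((fderiv ℝ g 0).comp (conjCLM.comp (fderiv ℝ O.F 0))) 0 :=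
    HasFDerivAt.comp 0 (by rw [mirrorF_zero]; exact hg.hasFDerivAt) h0
  have h2 := (h1.congr_of_eventuallyEq (hk.mono fun q hq => hq.symm)).fderiv
  rw [h2]
  simp only [ContinuousLinearMap.comp_apply, h.fderiv_apply, conjCLM_apply]
  rw [← map_neg]
  simp

theorem fderiv_jacYX_eq : fderiv ℝ O.jacYX 0 (0, 1) = fderiv ℝ O.jacYY 0 (1, 0) := by
  have hF := O.contDiffAt_F O.hitsTimes_inLine_zero
  have hsymm : IsSymmSndFDerivAt ℝ O.F 0 := hF.isSymmSndFDerivAt (by simp; norm_num)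
  have hd : DifferentiableAt ℝ (fderiv ℝ O.F) 0 :=
    (hF.fderiv_right (m := 3) (by norm_num)).differentiableAt (by norm_num)
  have key : ∀ v w : ℝ × ℝ, fderiv ℝ (fun q => (fderiv ℝ O.F q v).2) 0 w =
      (fderiv ℝ (fderiv ℝ O.F) 0 w v).2 := fun v w => by
    have h1 : HasFDerivAt (fun q => fderiv ℝ O.F q v)
        ((ContinuousLinearMap.apply ℝ (ℝ × ℝ) v).comp (fderiv ℝ (fderiv ℝ O.F) 0)) 0 :=
      (ContinuousLinearMap.apply ℝ (ℝ × ℝ) v).hasFDerivAt.comp 0 hd.hasFDerivAt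
    rw [h1.snd.fderiv]
    simp
  have e1 := key (1, 0) (0, 1)
  have e2 := key (0, 1) (1, 0)
  rw [hsymm.eq] at e1
  exact e1.trans e2.symm

theorem fderiv_jacXX_eq : fderiv ℝ O.jacXX 0 (1, 0) = 2 * O.a20 := by
  have hline : ∀ x : ℝ, HasDerivAt (fun x : ℝ => ((x, 0) : ℝ × ℝ)) (1, 0) x := fun x =>
    (hasDerivAt_id x).prodMk (hasDerivAt_const x 0)
  have ht : Tendsto (fun x : ℝ => ((x, 0) : ℝ × ℝ)) (𝓝 0) (𝓝 0) := (hline 0).continuousAt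
  have h1 : deriv (fun x : ℝ => (O.F (x, 0)).1) =ᶠ[𝓝 0] fun x => O.jacXX (x, 0) := by
    filter_upwards [ht.eventually O.eventually_hitsTimes] with x hx
    have hd := HasFDerivAt.comp_hasDerivAt (l := O.F) (f := fun x : ℝ => ((x, 0) : ℝ × ℝ)) x
      (hasFDerivAt_F hx) (hline x)
    exact (HasFDerivAt.comp_hasDerivAt (l := Prod.fst) x
      (hasFDerivAt_fst (𝕜 := ℝ) (p := O.F (x, 0))) hd).deriv
  have h2 : HasFDerivAt O.jacXX (fderiv ℝ O.jacXX 0) 0 :=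
    ((contDiffAt_jacXX O.hitsTimes_inLine_zero).differentiableAt (by norm_num)).hasFDerivAt
  have h3 : deriv (fun x : ℝ => O.jacXX (x, 0)) 0 = fderiv ℝ O.jacXX 0 (1, 0) :=
    (HasFDerivAt.comp_hasDerivAt (0 : ℝ) (l := O.jacXX) (f := fun x : ℝ => ((x, 0) : ℝ × ℝ)) h2
      (hline 0)).deriv
  rw [a20, iteratedDeriv_succ, iteratedDeriv_one, h1.deriv_eq, h3]
  ring

/-- The `x`-derivative of `jacYX` is its own negative, hence zero. Its `y`-derivative equals `∂ₓ
jacYY`, by symmetry of second derivatives, and this is `-∂ₓ jacXX`, by reversibility. -/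
theorem HasLinearization.fderiv_jacYX (h : O.HasLinearization β) (v : ℝ × ℝ) :
    fderiv ℝ O.jacYX 0 v = -(2 * O.a20) * v.2 := by
  have h0 := O.hitsTimes_inLine_zero
  have e1 := h.fderiv_comp_mirrorF ((contDiffAt_jacYX h0).differentiableAt (by norm_num))
    (eventually_jac_mirrorF.mono fun q hq => hq.1)
  have e2 := h.fderiv_comp_mirrorF ((contDiffAt_jacYY h0).differentiableAt (by norm_num))
    (eventually_jac_mirrorF.mono fun q hq => hq.2)
  rw [fderiv_jacXX_eq] at e2
  rw [apply_eq_smul_add_smul, fderiv_jacYX_eq]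
  simp only [smul_eq_mul]
  linear_combination v.1 / 2 * e1 + v.2 * e2

/-! ## The symmetry function -/

/-- One equation, `F_x = x`, determines `f`, because the `x`-derivative of `F_x - x` at the origin
is `-2`. The second equation then holds automatically by reversibility. -/
theorem HasLinearization.exists_isSymmetryFunction (h : O.HasLinearization β) (hβ : β ≠ 0) :
    ∃ ε₀ > 0, ∃ δ > 0, ∃ f : ℝ → ℝ, ContDiffAt ℝ 4 f 0 ∧
      ∀ ε ≤ ε₀, O.IsSymmetryFunction β ε δ f := by
  have hF := O.contDiffAt_F O.hitsTimes_inLine_zero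
  have hF' := hasFDerivAt_F O.hitsTimes_inLine_zero
  set u : ℝ × ℝ → ℝ := fun q => (O.F q).1 - q.1 with hu
  have hu4 : ContDiffAt ℝ 4 u 0 := hF.fst.sub contDiffAt_fst
  have hu0 : u 0 = 0 := by simp [hu, F_zero]
  have hud : HasFDerivAt u _ 0 := hF'.fst.sub hasFDerivAt_fst
  obtain ⟨σ, hσ, hσ0, hσ1, hσ2⟩ := exists_local_inverse hu4 (by
    rw [hud.fderiv]
    simp [h.fderiv_apply]
    norm_num)
  rw [hu0] at hσ hσ0 hσ1
  have hline : ContDiff ℝ 4 (fun y : ℝ => ((0, y) : ℝ × ℝ)) := contDiff_const.prodMk contDiff_id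
  have hlt : Tendsto (fun y : ℝ => ((0, y) : ℝ × ℝ)) (𝓝 0) (𝓝 (0, 0)) :=
    hline.continuous.continuousAt
  set f : ℝ → ℝ := fun y => σ (0, y) with hf
  have hf0 : f 0 = 0 := hσ0
  have hf4 : ContDiffAt ℝ 4 f 0 := ContDiffAt.comp 0 hσ hline.contDiffAt
  have hfd : DifferentiableAt ℝ f 0 := hf4.differentiableAt (by norm_num)
  have hfc : Tendsto f (𝓝 0) (𝓝 0) := by
    have := hfd.continuousAt.tendsto
    rwa [hf0] at this
  have hcurve : Tendsto (fun y => (f y, y)) (𝓝 0) (𝓝 (0 : ℝ × ℝ)) := hfc.prodMk_nhds tendsto_id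
  have hfix : ∀ᶠ y in 𝓝 0, (O.F (f y, y)).1 = f y := by
    filter_upwards [hlt.eventually hσ1] with y hy
    simp only [hu] at hy
    exact sub_eq_zero.1 hy
  have hf' : HasDerivAt f (β / 2) 0 := by
    have hc : HasDerivAt (fun y => (f y, y)) (deriv f 0, 1) 0 :=
      hfd.hasDerivAt.prodMk (hasDerivAt_id 0)
    have h1 : HasDerivAt (fun y => (O.F (f y, y)).1) _ 0 :=
      (HasFDerivAt.comp_hasDerivAt (l := O.F) (0 : ℝ) (by rw [hf0]; exact hF') hc).fst
    have h2 := (h1.congr_of_eventuallyEq (hfix.mono fun y hy => hy.symm)).unique hfd.hasDerivAt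
    rw [h.fderiv_apply] at h2
    have h3 : deriv f 0 = β / 2 := by linear_combination -h2 / 2
    rw [← h3]
    exact hfd.hasDerivAt
  have hstrict : HasStrictDerivAt f (β / 2) 0 := hf4.hasStrictDerivAt' hf' (by norm_num)
  -- Local injectivity of `f`; this is where `β ≠ 0` enters.
  have hinv := (hstrict.hasStrictFDerivAt_equiv (div_ne_zero hβ two_ne_zero)).eventually_left_inverse
  have hconv : ∀ᶠ q in 𝓝 (0 : ℝ × ℝ), (O.F q).1 = q.1 → f q.2 = q.1 := by
    filter_upwards [hσ2] with q hq hx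
    rw [← hq]
    simp [hf, hu, hx]
  have hmir : Tendsto (fun y => O.mirrorF (f y, y)) (𝓝 0) (𝓝 0) := tendsto_mirrorF.comp hcurve
  have hmir2 : Tendsto (fun y => (O.mirrorF (f y, y)).2) (𝓝 0) (𝓝 0) :=
    (continuous_snd.tendsto (0 : ℝ × ℝ)).comp hmir
  -- The mirror image `(f y, y')` of `F (f y, y)` is mapped by `F` to `(f y, -y)`. So `F_x = x`
  -- holds there too, which gives `f y' = f y` and hence `y' = y`.
  have hsol : ∀ᶠ y in 𝓝 0, O.F (f y, y) = (f y, -y) := by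
    filter_upwards [hfix, hcurve.eventually O.eventually_hitsTimes, hmir.eventually hconv, hinv,
      hmir2.eventually hinv] with y h1 h2 h3 h4 h5
    have h6 : O.F (O.mirrorF (f y, y)) = (f y, -y) := O.F_reverse h2
    have h7 : (O.mirrorF (f y, y)).1 = f y := h1
    have h8 := h3 (by rw [h6, h7])
    rw [h7] at h8
    rw [h8, h4] at h5
    refine Prod.ext h1 ?_
    simp only [mirrorF] at h5
    simp only
    linarith
  obtain ⟨δ, hδ, hbox⟩ := Metric.eventually_nhds_iff.1 hconv
  -- The bound `|y| < δ` is included because uniqueness is known only on a ball of radius `δ` in the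
  -- maximum norm.
  have hall := ((hsol.and (hf4.eventually (by decide))).and
    (hfc.eventually (Ioo_mem_nhds (neg_lt_zero.2 hδ) hδ))).and
      (Ioo_mem_nhds (neg_lt_zero.2 hδ) hδ)
  obtain ⟨ε₀, hε₀, hball⟩ := Metric.eventually_nhds_iff.1 hall
  refine ⟨ε₀, hε₀, δ, hδ, f, hf4, fun ε hε => ⟨hf0, hf', fun y hy => ?_, fun y hy => ?_⟩⟩
  · have hy' : dist y 0 < ε₀ := by
      rw [Real.dist_0_eq_abs]
      exact (abs_lt.2 hy).trans_le hε
    exact (hball hy').1.1.2.contDiffWithinAt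
  · have hy' : dist y 0 < ε₀ := by
      rw [Real.dist_0_eq_abs]
      exact (abs_lt.2 hy).trans_le hε
    obtain ⟨⟨⟨h1, -⟩, h3⟩, h4⟩ := hball hy'
    refine ⟨h3, fun x hx => ⟨fun hxy => ?_, fun hxy => by rw [hxy, h1]⟩⟩
    refine (hbox (y := (x, y)) ?_ (by rw [hxy])).symm
    rw [Prod.dist_eq, max_lt_iff]
    simp only [Prod.fst_zero, Prod.snd_zero, Real.dist_0_eq_abs]
    exact ⟨abs_lt.2 hx, abs_lt.2 h4⟩

/-! ## The return map -/

variable (O)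

/-- The derivative of the free flight across the channel with respect to the direction angle, at
the angle `ω` and for the separation distance `L`. -/
noncomputable def flightSlope (L : ℝ) (n : ℕ) (ω : ℝ) : ℝ :=
  L * Real.cos ω + n * C.width * Real.sin ω + 2 * dot (C.Γ (O.s O.last)) (dir ω)

theorem freeFlight_eq (L : ℝ) (n : ℕ) (z : ℝ × ℝ) : C.freeFlight L n z =
    (-z.1 + L * Real.sin z.2 - n * C.width * Real.cos z.2, 3 * Real.pi - z.2) := by
  have h1 : Real.cos (3 * Real.pi - z.2) = -Real.cos z.2 := by
    rw [show 3 * Real.pi - z.2 = Real.pi - z.2 + 2 * Real.pi by ring, Real.cos_add_two_pi,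
      Real.cos_pi_sub]
  have h2 : Real.sin (3 * Real.pi - z.2) = Real.sin z.2 := by
    rw [show 3 * Real.pi - z.2 = Real.pi - z.2 + 2 * Real.pi by ring, Real.sin_add_two_pi,
      Real.sin_pi_sub]
  simp only [freeFlight, dot_perp_dir, h1, h2]
  ext
  · simp only [perp, dir, Prod.smul_mk, Prod.mk_add_mk, smul_eq_mul]
    linear_combination -z.1 * Real.sin_sq_add_cos_sq z.2
  · rfl

/-- In local coordinates the flight is `-id` followed by a shear. The mirror symmetry of the first
and last reflection points merges their two contributions into the factor `2`. -/
theorem inCoord_freeFlight_outLine (L : ℝ) (n : ℕ) (q : ℝ × ℝ) :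
    O.inCoord (C.freeFlight L n (O.outLine q)) =
      (-q.1 + (L * Real.sin (O.ωOut + q.2) - n * C.width * Real.cos (O.ωOut + q.2)
        - 2 * dot (C.Γ (O.s O.last)) (perp (dir (O.ωOut + q.2)))), -q.2) := by
  rw [freeFlight_eq]
  have h : 3 * Real.pi - (O.ωOut + q.2) =
      Real.pi - (O.ωOut + q.2) + 2 * Real.pi * (1 : ℤ) := by push_cast; ring
  simp only [inCoord, outLine]
  rw [h, dir_add_int_mul_two_pi, dot_Γ_first]
  ext
  · ring
  · simp only [ωOut]; push_cast; ring

/-- `sep` is the value of `L` for which the shear term at `-y` equals `2 * f y`, so that `-f y` is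
carried back to `f y`. -/
theorem returnMap_zero {f : ℝ → ℝ} {y : ℝ} (hF : O.F (f y, y) = (f y, -y))
    (hs : Real.sin (O.ωOut - y) ≠ 0) (n : ℕ) : O.returnMap f n y 0 = 0 := by
  rw [returnMap, add_zero, hF, inCoord_freeFlight_outLine, sep, ← sub_eq_add_neg]
  ext
  · simp only [Prod.fst_sub, Prod.fst_zero]
    rw [div_mul_cancel₀ _ hs]
    ring
  · simp

theorem hasFDerivAt_returnMap {f : ℝ → ℝ} {y : ℝ} (hF : O.F (f y, y) = (f y, -y))
    (hh : C.HitsTimes (O.last + 1) (O.inLine (f y, y))) (n : ℕ) :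
    HasFDerivAt (O.returnMap f n y)
      (((-ContinuousLinearMap.fst ℝ ℝ ℝ + O.flightSlope (O.sep f n y) n (O.ωOut - y) •
        ContinuousLinearMap.snd ℝ ℝ ℝ).prod (-ContinuousLinearMap.snd ℝ ℝ ℝ)).comp
          (fderiv ℝ O.F (f y, y))) 0 := by
  set L := O.sep f n y
  set g : ℝ → ℝ := fun v => L * Real.sin (O.ωOut + v) - n * C.width * Real.cos (O.ωOut + v)
        - 2 * dot (C.Γ (O.s O.last)) (perp (dir (O.ωOut + v))) with hg
  have hgd : HasDerivAt g (O.flightSlope L n (O.ωOut - y)) (-y) := by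
    have hω : HasDerivAt (fun v => O.ωOut + v) 1 (-y) := (hasDerivAt_id _).const_add _
    have hsin := hω.sin
    have hcos := hω.cos
    simp only [hg, dot_perp_dir]
    refine (((hsin.const_mul L).sub (hcos.const_mul (n * C.width))).sub
      (((hcos.const_mul (C.Γ (O.s O.last)).2).sub
        (hsin.const_mul (C.Γ (O.s O.last)).1)).const_mul 2)).congr_deriv ?_
    simp only [flightSlope, dot, dir, ← sub_eq_add_neg]
    ring
  set ψ : ℝ × ℝ → ℝ × ℝ := fun q => (-q.1 + g q.2, -q.2) with hψ
  have hψd : HasFDerivAt ψ _ (f y, -y) :=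
    ((hasFDerivAt_fst (𝕜 := ℝ) (p := (f y, -y))).neg.add
      (HasDerivAt.comp_hasFDerivAt (h₂ := g) (f y, -y) hgd hasFDerivAt_snd)).prodMk
      (hasFDerivAt_snd (𝕜 := ℝ) (p := (f y, -y))).neg
  have hFd : HasFDerivAt (fun q => O.F ((f y, y) + q)) (fderiv ℝ O.F (f y, y)) 0 := by
    rw [hasFDerivAt_comp_add_left, add_zero]
    exact hasFDerivAt_F hh
  have hcomp : HasFDerivAt (fun q => ψ (O.F ((f y, y) + q))) _ 0 :=
    HasFDerivAt.comp (0 : ℝ × ℝ) (g := ψ) (by rw [add_zero, hF]; exact hψd) hFd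
  have heq : O.returnMap f n y = fun q => ψ (O.F ((f y, y) + q)) - (f y, y) := by
    funext q
    rw [returnMap, inCoord_freeFlight_outLine]
  rw [heq]
  exact hcomp.sub_const _

theorem monodromyTrace_eq {f : ℝ → ℝ} {y : ℝ} (hF : O.F (f y, y) = (f y, -y))
    (hh : C.HitsTimes (O.last + 1) (O.inLine (f y, y))) (n : ℕ) :
    O.monodromyTrace f n y = -(O.jacXX (f y, y) + O.jacYY (f y, y))
      + O.flightSlope (O.sep f n y) n (O.ωOut - y) * O.jacYX (f y, y) := by
  rw [monodromyTrace, trace_prod_eq, (O.hasFDerivAt_returnMap hF hh n).fderiv]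
  simp [jacXX, jacYX, jacYY]
  ring

theorem cos_ωOut_neg : Real.cos O.ωOut < 0 := by
  have h1 := O.angle_gt
  have h2 := O.angle_lt
  rw [ωOut, show 3 * Real.pi - O.ω 0 = 2 * Real.pi - O.ω 0 + Real.pi by ring, Real.cos_add_pi,
    neg_lt_zero]
  exact Real.cos_pos_of_mem_Ioo ⟨by linarith [Real.pi_pos], by linarith⟩

theorem sin_ωOut_neg : Real.sin O.ωOut < 0 := by
  have h1 := O.angle_gt
  have h2 := O.angle_lt
  rw [ωOut, show 3 * Real.pi - O.ω 0 = 2 * Real.pi - O.ω 0 + Real.pi by ring, Real.sin_add_pi,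
    neg_lt_zero]
  exact Real.sin_pos_of_pos_of_lt_pi (by linarith) (by linarith [Real.pi_pos])

theorem width_pos (O : CompleteSymmetricSequence C) : 0 < C.width := by
  obtain ⟨τ, -, -, h1, h2⟩ := O.comes_in
  linarith

/-! ## The trace and the separation distance as functions of `n` -/

/-- The part of `L_n` that does not depend on `n`. -/
noncomputable def sepConst (f : ℝ → ℝ) (y : ℝ) : ℝ :=
  (2 * f y + 2 * dot (C.Γ (O.s O.last)) (perp (dir (O.ωOut - y)))) / Real.sin (O.ωOut - y)

/-- The coefficient of `n` in `L_n`. -/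
noncomputable def sepSlope (y : ℝ) : ℝ :=
  C.width * Real.cos (O.ωOut - y) / Real.sin (O.ωOut - y)

theorem sep_eq (f : ℝ → ℝ) (n : ℕ) (y : ℝ) :
    O.sep f n y = O.sepConst f y + n * O.sepSlope y := by
  rw [sep, sepConst, sepSlope]
  ring

/-- The part of `2 - tr D T_y(0, 0)` that does not depend on `n`. -/
noncomputable def traceConst (f : ℝ → ℝ) (y : ℝ) : ℝ :=
  2 + (O.jacXX (f y, y) + O.jacYY (f y, y))
    - O.flightSlope (O.sepConst f y) 0 (O.ωOut - y) * O.jacYX (f y, y)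

/-- The coefficient of `n` in `2 - tr D T_y(0, 0)`. -/
noncomputable def traceSlope (f : ℝ → ℝ) (y : ℝ) : ℝ :=
  -(O.sepSlope y * Real.cos (O.ωOut - y) + C.width * Real.sin (O.ωOut - y)) * O.jacYX (f y, y)

theorem two_sub_monodromyTrace {f : ℝ → ℝ} {y : ℝ} (hF : O.F (f y, y) = (f y, -y))
    (hh : C.HitsTimes (O.last + 1) (O.inLine (f y, y))) (n : ℕ) :
    2 - O.monodromyTrace f n y = O.traceConst f y + n * O.traceSlope f y := by
  rw [O.monodromyTrace_eq hF hh, traceConst, traceSlope, sep_eq, flightSlope, flightSlope]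
  push_cast
  ring

theorem contDiff_ωOut_sub {m : WithTop ℕ∞} : ContDiff ℝ m fun y => O.ωOut - y :=
  contDiff_const.sub contDiff_id

theorem sin_ωOut_sub_zero_ne : Real.sin (O.ωOut - 0) ≠ 0 := by
  rw [sub_zero]
  exact O.sin_ωOut_neg.ne

theorem contDiffAt_sepSlope : ContDiffAt ℝ 2 O.sepSlope 0 :=
  ((contDiff_const.mul (Real.contDiff_cos.comp O.contDiff_ωOut_sub)).contDiffAt).div
    (Real.contDiff_sin.comp O.contDiff_ωOut_sub).contDiffAt O.sin_ωOut_sub_zero_ne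

theorem deriv_sepSlope : deriv O.sepSlope 0 = C.width / Real.sin O.ωOut ^ 2 := by
  have hω : HasDerivAt (fun v => O.ωOut - v) (-1) 0 := (hasDerivAt_id _).const_sub _
  have h1 : HasDerivAt O.sepSlope _ 0 :=
    (hω.cos.const_mul C.width).div hω.sin O.sin_ωOut_sub_zero_ne
  rw [h1.deriv, sub_zero]
  congr 1
  linear_combination C.width * Real.sin_sq_add_cos_sq O.ωOut

variable {f : ℝ → ℝ}

theorem contDiffAt_sepConst (hf : ContDiffAt ℝ 4 f 0) : ContDiffAt ℝ 2 (O.sepConst f) 0 :=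
  ((contDiffAt_const.mul (hf.of_le (by norm_num))).add (contDiffAt_const.mul
    (((contDiff_dot_perp _).of_le (by norm_num)).comp O.contDiff_ωOut_sub).contDiffAt)).div
    (Real.contDiff_sin.comp O.contDiff_ωOut_sub).contDiffAt O.sin_ωOut_sub_zero_ne

theorem contDiffAt_comp_curve {g : ℝ × ℝ → ℝ} (hg : ContDiffAt ℝ 3 g 0)
    (hf : ContDiffAt ℝ 4 f 0) (hf0 : f 0 = 0) : ContDiffAt ℝ 2 (fun y => g (f y, y)) 0 := by
  have h1 : ContDiffAt ℝ 2 (fun y => (f y, y)) 0 := (hf.of_le (by norm_num)).prodMk contDiffAt_id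
  refine ContDiffAt.comp (g := g) 0 ?_ h1
  rw [hf0]
  exact hg.of_le (by norm_num)

theorem contDiffAt_traceConst (hf : ContDiffAt ℝ 4 f 0) (hf0 : f 0 = 0) :
    ContDiffAt ℝ 2 (O.traceConst f) 0 := by
  have h0 := O.hitsTimes_inLine_zero
  have hc : ContDiffAt ℝ 2 (fun y => Real.cos (O.ωOut - y)) 0 :=
    (Real.contDiff_cos.comp O.contDiff_ωOut_sub).contDiffAt
  have hs : ContDiffAt ℝ 2 (fun y => Real.sin (O.ωOut - y)) 0 :=
    (Real.contDiff_sin.comp O.contDiff_ωOut_sub).contDiffAt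
  refine (contDiffAt_const.add ((contDiffAt_comp_curve (contDiffAt_jacXX h0) hf hf0).add
    (contDiffAt_comp_curve (contDiffAt_jacYY h0) hf hf0))).sub (ContDiffAt.mul ?_
      (contDiffAt_comp_curve (contDiffAt_jacYX h0) hf hf0))
  simp only [flightSlope, dot, dir]
  exact (((O.contDiffAt_sepConst hf).mul hc).add (contDiffAt_const.mul hs)).add
    (contDiffAt_const.mul ((contDiffAt_const.mul hc).add (contDiffAt_const.mul hs)))

theorem contDiffAt_traceSlope (hf : ContDiffAt ℝ 4 f 0) (hf0 : f 0 = 0) :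
    ContDiffAt ℝ 2 (O.traceSlope f) 0 := by
  have hc : ContDiffAt ℝ 2 (fun y => Real.cos (O.ωOut - y)) 0 :=
    (Real.contDiff_cos.comp O.contDiff_ωOut_sub).contDiffAt
  have hs : ContDiffAt ℝ 2 (fun y => Real.sin (O.ωOut - y)) 0 :=
    (Real.contDiff_sin.comp O.contDiff_ωOut_sub).contDiffAt
  exact ((O.contDiffAt_sepSlope.mul hc).add (contDiffAt_const.mul hs)).neg.mul
    (contDiffAt_comp_curve (contDiffAt_jacYX O.hitsTimes_inLine_zero) hf hf0)

variable {O}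

theorem HasLinearization.traceConst_zero (h : O.HasLinearization β) (hf0 : f 0 = 0) :
    O.traceConst f 0 = 0 := by
  obtain ⟨h1, h2, h3⟩ := h.jac_zero
  have e : ((0, 0) : ℝ × ℝ) = 0 := rfl
  rw [traceConst, hf0, e, h1, h2, h3]
  norm_num

theorem HasLinearization.traceSlope_zero (h : O.HasLinearization β) (hf0 : f 0 = 0) :
    O.traceSlope f 0 = 0 := by
  have e : ((0, 0) : ℝ × ℝ) = 0 := rfl
  rw [traceSlope, hf0, e, h.jac_zero.2.1, mul_zero]

/-- As `jacYX` vanishes at the origin, only its derivative `-2 a₂₀` along the curve contributes; it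
is multiplied by `-W (cos² / sin + sin) = -W / sin`. -/
theorem HasLinearization.deriv_traceSlope (h : O.HasLinearization β)
    (hf : ContDiffAt ℝ 4 f 0) (hf0 : f 0 = 0) :
    deriv (O.traceSlope f) 0 = 2 * O.a20 * C.width / Real.sin O.ωOut := by
  have hfd : HasDerivAt f (deriv f 0) 0 := (hf.differentiableAt (by norm_num)).hasDerivAt
  have hc : HasDerivAt (fun y => (f y, y)) (deriv f 0, 1) 0 := hfd.prodMk (hasDerivAt_id 0)
  have h1 : HasFDerivAt O.jacYX (fderiv ℝ O.jacYX 0) 0 :=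
    ((contDiffAt_jacYX O.hitsTimes_inLine_zero).differentiableAt (by norm_num)).hasFDerivAt
  have h2 : HasDerivAt (fun y => O.jacYX (f y, y)) _ 0 :=
    HasFDerivAt.comp_hasDerivAt (l := O.jacYX) (0 : ℝ) (by rw [hf0]; exact h1) hc
  rw [h.fderiv_jacYX] at h2
  have hω : HasDerivAt (fun v => O.ωOut - v) (-1) 0 := (hasDerivAt_id _).const_sub _
  have h3 : HasDerivAt O.sepSlope _ 0 :=
    (O.contDiffAt_sepSlope.differentiableAt (by norm_num)).hasDerivAt
  have h4 : HasDerivAt (O.traceSlope f) _ 0 :=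
    ((h3.mul hω.cos).add (hω.sin.const_mul C.width)).neg.mul h2
  rw [h4.deriv]
  have e : O.jacYX (f 0, 0) = 0 := by rw [hf0]; exact h.jac_zero.2.1
  rw [e, mul_zero, zero_add]
  simp only [Pi.neg_apply, Pi.add_apply, Pi.mul_apply, sepSlope, sub_zero]
  have hs := O.sin_ωOut_neg.ne
  field_simp
  linear_combination C.width * O.a20 * Real.sin_sq_add_cos_sq O.ωOut

end CompleteSymmetricSequence

/-! ### Closing a half orbit by an involution -/

theorem exists_periodic_of_involutive {α : Type*} {step : α → α → Prop} {M : α → α}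
    (hM : Function.Involutive M) (hstep : ∀ x y, step x y → step (M x) (M y)) {m : ℕ} (hm : 0 < m)
    {w : ℕ → α} (hw : ∀ k, k + 1 < m → step (w k) (w (k + 1)))
    (hlast : step (w (m - 1)) (M (w 0))) :
    ∃ z : ℕ → α, (∀ k, step (z k) (z (k + 1))) ∧ (∀ k, z (k + 2 * m) = z k) ∧
      ∀ k < m, z k = w k := by
  have hiter : ∀ (i : ℕ) x y, step x y → step (M^[i] x) (M^[i] y) := fun i => by
    induction i with
    | zero => exact fun x y h => h
    | succ i ih =>
      intro x y h
      rw [Function.iterate_succ_apply', Function.iterate_succ_apply']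
      exact hstep _ _ (ih _ _ h)
  -- Successive blocks of length `m` are copies of `w` under successive powers of `M`; after two
  -- blocks `M ∘ M = id` closes the sequence.
  refine ⟨fun k => M^[k / m] (w (k % m)), fun k => ?_, fun k => ?_, fun k hk => ?_⟩
  · have hdm := Nat.div_add_mod k m
    have hlt := Nat.mod_lt k hm
    by_cases h : k % m + 1 < m
    · have e1 : (k + 1) / m = k / m := by
        rw [Nat.div_eq_iff hm]
        constructor <;> lia
      have e2 : (k + 1) % m = k % m + 1 := by
        rw [Nat.add_mod, Nat.mod_eq_of_lt (show 1 < m by lia), Nat.mod_eq_of_lt h]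
      simp only [e1, e2]
      exact hiter _ _ _ (hw _ h)
    · have hk : k % m = m - 1 := by lia
      have e0 : k + 1 = m * (k / m + 1) := by rw [mul_add]; lia
      have e1 : (k + 1) / m = k / m + 1 := by rw [e0, Nat.mul_div_cancel_left _ hm]
      have e2 : (k + 1) % m = 0 := by rw [e0, Nat.mul_mod_right]
      simp only [e1, e2, hk, Function.iterate_succ_apply]
      exact hiter _ _ _ hlast
  · have e1 : (k + 2 * m) / m = k / m + 2 := Nat.add_mul_div_right _ _ hm
    simp only [e1, Nat.add_mul_mod_self_right, Function.iterate_add_apply]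
    congr 1
    exact hM _
  · simp [Nat.div_eq_of_lt hk, Nat.mod_eq_of_lt hk]

namespace CurvedComponent

variable {C : CurvedComponent} {L : ℝ}

/-! ## Symmetries and supporting lines of the table -/

/-- The symmetries `(x, y) ↦ (-x - L, ± y)` of the table, on points and velocities. -/
def tableSymm (L e : ℝ) (z : (ℝ × ℝ) × (ℝ × ℝ)) : (ℝ × ℝ) × (ℝ × ℝ) :=
  ((-z.1.1 - L, e * z.1.2), (-z.2.1, e * z.2.2))

theorem tableSymm_involutive {e : ℝ} (he : e * e = 1) : Function.Involutive (tableSymm L e) := by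
  rintro ⟨⟨a, b⟩, ⟨c, d⟩⟩
  simp only [tableSymm, neg_neg, ← mul_assoc, he, one_mul]
  simp

/-- A symmetry may reverse the chosen orientation of the tangent. The sign `σ` is harmless, since
the reflection law is quadratic in the tangent. -/
theorem IsBoundaryTangent.symm {p t : ℝ × ℝ} (h : C.IsBoundaryTangent L p t) {e : ℝ}
    (he : e = 1 ∨ e = -1) : ∃ σ : ℝ, σ * σ = 1 ∧
      C.IsBoundaryTangent L (-p.1 - L, e * p.2) (σ • (-t.1, e * t.2)) := by
  rcases h with ⟨s, hs, rfl, rfl⟩ | ⟨s, hs, rfl, rfl⟩ | ⟨hp, hp2, rfl⟩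
  · rcases he with rfl | rfl
    · exact ⟨1, by norm_num, Or.inr (Or.inl ⟨s, hs, by simp, by simp [dir]⟩)⟩
    · refine ⟨-1, by norm_num, Or.inr (Or.inl ⟨C.len - s, len_sub_mem hs, ?_, ?_⟩)⟩
      · simp [C.symmetric s hs]
      · simp [dir, θ_len_sub hs]
  · rcases he with rfl | rfl
    · exact ⟨1, by norm_num, Or.inl ⟨s, hs, by simp, by simp [dir]⟩⟩
    · refine ⟨-1, by norm_num, Or.inl ⟨C.len - s, len_sub_mem hs, ?_, ?_⟩⟩
      · simp [C.symmetric s hs]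
      · simp [dir, θ_len_sub hs]
  · refine ⟨-1, by norm_num, Or.inr (Or.inr ⟨⟨?_, ?_⟩, ?_, by simp⟩)⟩
    · simp only; linarith [hp.2]
    · simp only; linarith [hp.1]
    · rcases he with rfl | rfl
      · simpa using hp2
      · rcases hp2 with h | h <;> simp [h]

theorem mem_tableBoundary_symm {p : ℝ × ℝ} (h : p ∈ C.tableBoundary L) {e : ℝ}
    (he : e = 1 ∨ e = -1) : (-p.1 - L, e * p.2) ∈ C.tableBoundary L := by
  obtain ⟨t, ht⟩ := h
  obtain ⟨σ, -, h'⟩ := ht.symm he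
  exact ⟨_, h'⟩

theorem BilliardStep.symm {z z' : (ℝ × ℝ) × (ℝ × ℝ)} (h : C.BilliardStep L z z') {e : ℝ}
    (he : e = 1 ∨ e = -1) : C.BilliardStep L (tableSymm L e z) (tableSymm L e z') := by
  have hee : e * e = 1 := by rcases he with rfl | rfl <;> norm_num
  obtain ⟨h1, ⟨τ, hτ, h2⟩, h3, t, ht, h4⟩ := h
  refine ⟨mem_tableBoundary_symm h1 he, ⟨τ, hτ, ?_⟩, ?_, ?_⟩
  · simp only [tableSymm, h2]
    ext
    · simp only [Prod.fst_add, Prod.smul_fst, smul_eq_mul]; ring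
    · simp only [Prod.snd_add, Prod.smul_snd, smul_eq_mul]; ring
  · rw [Set.disjoint_left] at h3 ⊢
    rintro q ⟨a, b, ha, hb, hab, rfl⟩ hq
    refine h3 ⟨a, b, ha, hb, hab, rfl⟩ ?_
    convert mem_tableBoundary_symm hq he using 1
    have hb' : b = 1 - a := by linarith
    ext
    · simp only [tableSymm, Prod.fst_add, Prod.smul_fst, smul_eq_mul, hb']; ring
    · simp only [tableSymm, Prod.snd_add, Prod.smul_snd, smul_eq_mul]
      linear_combination -(a * z.1.2 + b * z'.1.2) * hee
  · obtain ⟨σ, hσ, h'⟩ := ht.symm he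
    refine ⟨_, h', ?_⟩
    simp only [tableSymm, h4]
    ext
    · simp only [dot, Prod.fst_sub, Prod.smul_fst, Prod.smul_snd, smul_eq_mul]
      linear_combination (2 * z.2.1 * t.1 * t.1 + 2 * e * e * z.2.2 * t.2 * t.1) * hσ
        + 2 * z.2.2 * t.2 * t.1 * hee
    · simp only [dot, Prod.snd_sub, Prod.smul_fst, Prod.smul_snd, smul_eq_mul]
      linear_combination -(2 * e * z.2.1 * t.1 * t.2 + 2 * e * e * e * z.2.2 * t.2 * t.2) * hσ
        - 2 * e * z.2.2 * t.2 * t.2 * hee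

/-- Every boundary point is a point of `Γ` pushed to the left. Since `sin θ ≥ 0`, such a push stays
on the inner side of the tangents of `Γ`, so these tangents support the whole table. -/
theorem exists_eq_sub_of_mem_tableBoundary (hL : 0 ≤ L) {p : ℝ × ℝ}
    (h : p ∈ C.tableBoundary L) :
    ∃ w ∈ Icc 0 C.len, ∃ a : ℝ, 0 ≤ a ∧ p = ((C.Γ w).1 - a, (C.Γ w).2) := by
  obtain ⟨t, ⟨s, hs, rfl, -⟩ | ⟨s, hs, rfl, -⟩ | ⟨hp, hp2, -⟩⟩ := h
  · exact ⟨s, hs, 0, le_rfl, by simp⟩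
  · refine ⟨s, hs, 2 * (C.Γ s).1 + L, by linarith [Γ_fst_nonneg hs], ?_⟩
    ext
    · simp only; ring
    · rfl
  · rcases hp2 with h | h
    · exact ⟨C.len, C.len_mem, -p.1, by linarith [hp.2], by ext <;> simp [Γ_len_eq, h]⟩
    · exact ⟨0, C.zero_mem, -p.1, by linarith [hp.2], by ext <;> simp [Γ_zero_eq, h]⟩

theorem dot_sub_support_nonneg (hL : 0 ≤ L) {u : ℝ} (hu : u ∈ Icc 0 C.len) {q : ℝ × ℝ}
    (hq : q ∈ C.tableBoundary L) :
    0 ≤ dot q (perp (dir (C.θ u))) - dot (C.Γ u) (perp (dir (C.θ u))) := by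
  obtain ⟨w, hw, a, ha, rfl⟩ := exists_eq_sub_of_mem_tableBoundary hL hq
  have h1 := support_nonneg hu hw
  have h2 : 0 ≤ Real.sin (C.θ u) :=
    Real.sin_nonneg_of_nonneg_of_le_pi (θ_mem hu).1 (θ_mem hu).2
  rw [dot_perp_dir, dot_perp_dir] at h1 ⊢
  simp only
  nlinarith [mul_nonneg ha h2]

theorem perp_dir_ne_zero (ω : ℝ) : perp (dir ω) ≠ 0 := fun h => by
  have h1 := congrArg Prod.fst h
  have h2 := congrArg Prod.snd h
  simp only [perp, dir, Prod.fst_zero, Prod.snd_zero, neg_eq_zero] at h1 h2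
  have := Real.sin_sq_add_cos_sq ω
  rw [h1, h2] at this
  norm_num at this

/-- Tangents of `Γ` serve the right arc and, mirrored, the left arc; the walls lie on the tangents
at the end points, where `θ` is `0` and `π`. -/
theorem exists_supporting_normal (hL : 0 ≤ L) {p : ℝ × ℝ} (hp : p ∈ C.tableBoundary L) :
    ∃ ν : ℝ × ℝ, ν ≠ 0 ∧ ∀ q ∈ C.tableBoundary L, dot p ν ≤ dot q ν := by
  obtain ⟨t, ⟨s, hs, rfl, -⟩ | ⟨s, hs, rfl, -⟩ | ⟨hp1, hp2, -⟩⟩ := hp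
  · exact ⟨_, perp_dir_ne_zero (C.θ s), fun q hq =>
      sub_nonneg.1 (dot_sub_support_nonneg hL hs hq)⟩
  · refine ⟨(-(perp (dir (C.θ s))).1, (perp (dir (C.θ s))).2), fun h => ?_, fun q hq => ?_⟩
    · refine perp_dir_ne_zero (C.θ s) (Prod.ext ?_ ?_)
      · simpa using congrArg Prod.fst h
      · simpa using congrArg Prod.snd h
    · have h1 := dot_sub_support_nonneg hL hs (mem_tableBoundary_symm hq (Or.inl rfl))
      simp only [dot] at h1 ⊢
      linarith
  · rcases hp2 with h | h
    · refine ⟨(0, -1), by simp, fun q hq => ?_⟩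
      have h1 := dot_sub_support_nonneg hL C.len_mem hq
      rw [C.θ_len, dot_perp_dir, dot_perp_dir, Γ_len_eq] at h1
      simp only [Real.cos_pi, Real.sin_pi] at h1
      simp only [dot, h]
      linarith
    · refine ⟨(0, 1), by simp, fun q hq => ?_⟩
      have h1 := dot_sub_support_nonneg hL C.zero_mem hq
      rw [C.θ_zero, dot_perp_dir, dot_perp_dir, Γ_zero_eq] at h1
      simp only [Real.cos_zero, Real.sin_zero] at h1
      simp only [dot, h]
      linarith

/-! ## Billiard steps -/

/-- A supporting line at a boundary point inside the segment would contain both end points of the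
segment. It would then support the table at `p'` as well, hence be tangent to the boundary curve `γ`
there, contradicting transversality of `v` and `t`. -/
theorem BilliardStep.of_transversal (hL : 0 ≤ L) {p v p' t : ℝ × ℝ} {τ : ℝ} {γ : ℝ → ℝ × ℝ}
    (hp : p ∈ C.tableBoundary L) (hτ : 0 < τ) (hp' : p' = p + τ • v)
    (ht : C.IsBoundaryTangent L p' t) (hγ0 : γ 0 = p') (hγ : HasDerivAt γ t 0)
    (hγb : ∀ᶠ u in 𝓝 0, γ u ∈ C.tableBoundary L) (hv : dot v (perp t) ≠ 0) :
    C.BilliardStep L (p, v) (p', (2 * dot v t) • t - v) := by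
  refine ⟨hp, ⟨τ, hτ, hp'⟩, ?_, t, ht, rfl⟩
  rw [Set.disjoint_left]
  rintro q ⟨a, b, ha, hb, hab, rfl⟩ hq
  obtain ⟨ν, hν, hmin⟩ := exists_supporting_normal hL hq
  have h1 := hmin p hp
  have h2 := hmin p' ⟨t, ht⟩
  simp only at h1 h2 hmin
  set q := a • p + b • p' with hqdef
  have h3 : dot q ν = a * dot p ν + b * dot p' ν := by
    simp only [hqdef, dot, Prod.fst_add, Prod.snd_add, Prod.smul_fst, Prod.smul_snd, smul_eq_mul]
    ring
  have hb' : b = 1 - a := by linarith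
  have h4 : dot p ν = dot q ν := by
    refine le_antisymm ?_ h1
    have : b * dot q ν ≤ b * dot p' ν := by gcongr
    have : a * dot p ν ≤ a * dot q ν := by rw [hb'] at this h3; linarith
    exact le_of_mul_le_mul_left this ha
  have h5 : dot p' ν = dot q ν := by
    refine le_antisymm ?_ h2
    have : b * dot p' ν ≤ b * dot q ν := by rw [h4, hb'] at h3; rw [hb']; linarith
    exact le_of_mul_le_mul_left this hb
  have h6 : dot v ν = 0 := by
    have : dot p' ν = dot p ν + τ * dot v ν := by
      rw [hp']
      simp only [dot, Prod.fst_add, Prod.snd_add, Prod.smul_fst, Prod.smul_snd, smul_eq_mul]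
      ring
    have : τ * dot v ν = 0 := by linarith
    exact (mul_eq_zero.1 this).resolve_left hτ.ne'
  have h7 : dot t ν = 0 := by
    have hd : HasDerivAt (fun u => dot (γ u) ν) (dot t ν) 0 := by
      have hfst : HasDerivAt (fun u => (γ u).1) t.1 0 := hγ.fst
      have hsnd : HasDerivAt (fun u => (γ u).2) t.2 0 := hγ.snd
      exact (hfst.mul_const _).add (hsnd.mul_const _)
    refine IsLocalMin.hasDerivAt_eq_zero ?_ hd
    filter_upwards [hγb] with u hu
    rw [hγ0, h5]
    exact hmin _ hu
  simp only [dot, perp] at h6 h7 hv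
  refine hν (Prod.ext ?_ ?_)
  · refine (mul_eq_zero.1 (?_ : (v.1 * -t.2 + v.2 * t.1) * ν.1 = 0)).resolve_left hv
    linear_combination v.2 * h7 - t.2 * h6
  · refine (mul_eq_zero.1 (?_ : (v.1 * -t.2 + v.2 * t.1) * ν.2 = 0)).resolve_left hv
    linear_combination t.1 * h6 - v.1 * h7

theorem IsHit.billiardStep (hL : 0 ≤ L) {z p : ℝ × ℝ} {s τ : ℝ} (h : C.IsHit z s)
    (hp : p ∈ C.tableBoundary L) (hτ : 0 < τ) (hs : C.Γ s = p + τ • dir z.2) :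
    C.BilliardStep L (p, dir z.2) (C.stateAfter z) := by
  have hs' := Ioo_subset_Icc_self h.1
  have e : C.stateAfter z =
      (C.Γ s, (2 * dot (dir z.2) (dir (C.θ s))) • dir (C.θ s) - dir z.2) := by
    rw [stateAfter, h.reflectLine_eq, h.hit_eq]
    have hsq := Real.sin_sq_add_cos_sq (C.θ s)
    ext
    · rfl
    · rfl
    · simp only [dir, dot, Prod.fst_sub, Prod.smul_fst, smul_eq_mul, Real.cos_sub,
        Real.cos_two_mul, Real.sin_two_mul]
      ring
    · simp only [dir, dot, Prod.snd_sub, Prod.smul_snd, smul_eq_mul, Real.sin_sub,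
        Real.cos_two_mul, Real.sin_two_mul]
      linear_combination -2 * Real.sin z.2 * hsq
  rw [e]
  have hshift : HasDerivAt (fun u : ℝ => s + u) 1 0 := (hasDerivAt_id _).const_add _
  refine BilliardStep.of_transversal (γ := fun u => C.Γ (s + u)) hL hp hτ hs
    (Or.inl ⟨s, hs', rfl, rfl⟩) (by simp) ?_ ?_ ?_
  · have h1 : HasDerivAt C.Γ (dir (C.θ s)) (s + 0) := by
      rw [add_zero]
      exact hasDerivAt_Γ h.1
    have h2 := h1.scomp 0 hshift
    rw [one_smul] at h2
    exact h2
  · have h2 : Tendsto (fun u : ℝ => s + u) (𝓝 0) (𝓝 s) := by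
      simpa using hshift.continuousAt.tendsto
    filter_upwards [h2.eventually (Icc_mem_nhds h.1.1 h.1.2)] with u hu
    exact ⟨_, Or.inl ⟨_, hu, rfl, rfl⟩⟩
  · have h3 := h.2.2
    rw [Real.sin_sub] at h3
    rw [dot_perp_dir]
    exact h3.ne

theorem billiardStep_wall (hL : 0 ≤ L) {p v : ℝ × ℝ} {x y τ : ℝ} (hp : p ∈ C.tableBoundary L)
    (hτ : 0 < τ) (hx : x ∈ Ioo (-L) 0) (hy : y = C.width / 2 ∨ y = -(C.width / 2))
    (hxy : (x, y) = p + τ • v) (hv : v.2 ≠ 0) :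
    C.BilliardStep L (p, v) ((x, y), (v.1, -v.2)) := by
  have e : (v.1, -v.2) = (2 * dot v (1, 0)) • ((1, 0) : ℝ × ℝ) - v := by
    ext <;> simp [dot]
    ring
  rw [e]
  have hshift : HasDerivAt (fun u : ℝ => x + u) 1 0 := (hasDerivAt_id _).const_add _
  refine BilliardStep.of_transversal (γ := fun u => (x + u, y)) hL hp hτ hxy
    (Or.inr (Or.inr ⟨Ioo_subset_Icc_self hx, hy, rfl⟩)) (by simp)
    (hshift.prodMk (hasDerivAt_const _ _)) ?_ ?_
  · have h2 : Tendsto (fun u : ℝ => x + u) (𝓝 0) (𝓝 x) := by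
      simpa using hshift.continuousAt.tendsto
    filter_upwards [h2.eventually (Icc_mem_nhds hx.1 hx.2)] with u hu
    exact ⟨_, Or.inr (Or.inr ⟨hu, hy, rfl⟩)⟩
  · simpa [dot, perp] using hv

theorem Γ_mem_tableBoundary {s : ℝ} (hs : s ∈ Icc 0 C.len) : C.Γ s ∈ C.tableBoundary L :=
  ⟨_, Or.inl ⟨s, hs, rfl, rfl⟩⟩

theorem eq_add_smul_dir {p q : ℝ × ℝ} {ω : ℝ}
    (h : dot p (perp (dir ω)) = dot q (perp (dir ω))) :
    q = p + dot (q - p) (dir ω) • dir ω := by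
  rw [dot_perp_dir, dot_perp_dir] at h
  have hsq := Real.sin_sq_add_cos_sq ω
  ext
  · simp only [dot, dir, Prod.fst_add, Prod.smul_fst, Prod.fst_sub, Prod.snd_sub, smul_eq_mul]
    linear_combination (p.1 - q.1) * hsq + Real.sin ω * h
  · simp only [dot, dir, Prod.snd_add, Prod.smul_snd, Prod.fst_sub, Prod.snd_sub, smul_eq_mul]
    linear_combination (p.2 - q.2) * hsq - Real.cos ω * h

/-! ## The periodic orbit -/

/-- The points where the outgoing line `z`, unfolded, crosses the copies of the lower wall. -/
noncomputable def wallX (C : CurvedComponent) (z : ℝ × ℝ) (j : ℕ) : ℝ :=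
  -((C.width / 2 + j * C.width) * Real.cos z.2 + z.1) / Real.sin z.2

/-- The half orbit consists of the `N + 1` reflections off `Γ` and `n` wall reflections; by
`hflight` its next state is a symmetric copy of the first one. -/
theorem exists_isPeriodicOrbit {N n : ℕ} {z z' : ℝ × ℝ} (hL : 0 ≤ L) (hn : 0 < n)
    (hW : 0 < C.width) (hz : C.HitsTimes (N + 1) z)
    (hfwd : ∀ k < N, 0 < dot (C.Γ (C.hit (C.reflectLine^[k + 1] z))
      - C.Γ (C.hit (C.reflectLine^[k] z))) (dir (C.reflectLine^[k + 1] z).2))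
    (hz' : C.reflectLine^[N + 1] z = z') (hcos : Real.cos z'.2 < 0) (hsin : Real.sin z'.2 < 0)
    (hdir : dir z.2 = (-Real.cos z'.2, Real.sin z'.2))
    (hflight : z.1 = -z'.1 + L * Real.sin z'.2 - n * C.width * Real.cos z'.2)
    (hin : z.1 < -(C.width / 2 * Real.cos z'.2)) (hout : z'.1 < -(C.width / 2 * Real.cos z'.2)) :
    ∃ w : ℕ → (ℝ × ℝ) × (ℝ × ℝ), C.IsPeriodicOrbit L (2 * (N + 1 + n)) w ∧
      ∀ k ≤ N, w k = C.stateAfter (C.reflectLine^[k] z) := by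
  set c := Real.cos z'.2 with hc
  set s := Real.sin z'.2 with hs
  set x : ℕ → ℝ := C.wallX z' with hx
  have hxs : ∀ j, x j * s = -((C.width / 2 + j * C.width) * c + z'.1) := fun j =>
    div_mul_cancel₀ _ hsin.ne
  -- The crossings move to the left as `j` grows. The first is left of `0` by `hout`, and the last
  -- is right of `-L` by `hin` and `hflight`.
  have hxmem : ∀ j < n, x j ∈ Ioo (-L) 0 := fun j hj => by
    have hj' : (j : ℝ) + 1 ≤ n := by exact_mod_cast hj
    have h0 : 0 ≤ (j : ℝ) * C.width * -c := by
      have := hcos.le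
      have : 0 ≤ -c := by linarith
      positivity
    have h1 : 0 ≤ ((n : ℝ) - (j + 1)) * C.width * -c :=
      mul_nonneg (mul_nonneg (by linarith) hW.le) (by linarith)
    have h2 := hxs j
    constructor
    · by_contra! h
      nlinarith [mul_le_mul_of_nonpos_right h hsin.le]
    · by_contra! h
      nlinarith [mul_nonpos_of_nonneg_of_nonpos h hsin.le]
  let e : ℕ → ℝ := fun j => (-1) ^ j
  have he : ∀ j, e j = 1 ∨ e j = -1 := fun j => neg_one_pow_eq_or ℝ j
  have hee : ∀ j, e j * e j = 1 := fun j => by rcases he j with h | h <;> rw [h] <;> norm_num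
  have hes : ∀ j, e (j + 1) = -e j := fun j => by simp only [e, pow_succ]; ring
  -- Folding back: the exponent `j + 1` makes the reflection number `0` take place at the lower wall
  -- and then alternates the walls and the vertical velocity.
  let wall : ℕ → (ℝ × ℝ) × (ℝ × ℝ) := fun j =>
    ((x j, e (j + 1) * (C.width / 2)), (c, e (j + 1) * s))
  have hwallmem : ∀ j, e j * (C.width / 2) = C.width / 2 ∨
      e j * (C.width / 2) = -(C.width / 2) := fun j => by
    rcases he j with h | h <;> simp [h]
  have hwallb : ∀ j < n, (wall j).1 ∈ C.tableBoundary L := fun j hj =>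
    ⟨(1, 0), Or.inr (Or.inr ⟨Ioo_subset_Icc_self (hxmem j hj), hwallmem _, rfl⟩)⟩
  let w : ℕ → (ℝ × ℝ) × (ℝ × ℝ) := fun k =>
    if k ≤ N then C.stateAfter (C.reflectLine^[k] z) else wall (k - (N + 1))
  have hbd : ∀ k ≤ N, C.Γ (C.hit (C.reflectLine^[k] z)) ∈ C.tableBoundary L := fun k hk =>
    Γ_mem_tableBoundary (Ioo_subset_Icc_self (hz k (Nat.lt_succ_iff.2 hk)).1)
  have hΓ0 : ∀ k ≤ N, 0 ≤ (C.Γ (C.hit (C.reflectLine^[k] z))).1 := fun k hk =>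
    Γ_fst_nonneg (Ioo_subset_Icc_self (hz k (Nat.lt_succ_iff.2 hk)).1)
  have harc : ∀ k < N, C.BilliardStep L (C.stateAfter (C.reflectLine^[k] z))
      (C.stateAfter (C.reflectLine^[k + 1] z)) := fun k hk => by
    have h1 := hz (k + 1) (by lia)
    have h2 : dot (C.Γ (C.hit (C.reflectLine^[k] z)))
        (perp (dir (C.reflectLine^[k + 1] z).2)) = (C.reflectLine^[k + 1] z).1 := by
      rw [Function.iterate_succ_apply']
      rfl
    have h3 := h1.billiardStep hL (hbd k hk.le) (hfwd k hk) (eq_add_smul_dir (h2.trans h1.2.1.symm))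
    rw [stateAfter, ← Function.iterate_succ_apply' C.reflectLine]
    exact h3
  have hfirst : C.BilliardStep L (C.stateAfter (C.reflectLine^[N] z)) (wall 0) := by
    have h1 : (C.Γ (C.hit (C.reflectLine^[N] z))).2 * c
        - (C.Γ (C.hit (C.reflectLine^[N] z))).1 * s = z'.1 := by
      rw [hc, hs, ← dot_perp_dir, ← hz', Function.iterate_succ_apply']
      rfl
    have h2 := hxs 0
    have h3 := hΓ0 N le_rfl
    rw [stateAfter, ← Function.iterate_succ_apply' C.reflectLine, hz']
    set P := C.Γ (C.hit (C.reflectLine^[N] z))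
    have h4 : 0 < (x 0 - P.1) / c := div_pos_of_neg_of_neg (by linarith [(hxmem 0 hn).2]) hcos
    have h5 := billiardStep_wall (v := dir z'.2) hL (hbd N le_rfl) h4 (hxmem 0 hn) (Or.inr rfl)
      (by
        ext
        · simp only [dir, Prod.fst_add, Prod.smul_fst, smul_eq_mul]
          rw [div_mul_cancel₀ _ hcos.ne]
          ring
        · simp only [dir, Prod.snd_add, Prod.smul_snd, smul_eq_mul]
          rw [div_mul_eq_mul_div, eq_comm, ← eq_sub_iff_add_eq', div_eq_iff hcos.ne]
          push_cast at h2
          linear_combination h2 + h1) hsin.ne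
    have h6 : wall 0 = ((x 0, -(C.width / 2)), ((dir z'.2).1, -(dir z'.2).2)) := by
      simp [wall, e, dir, hc, hs]
    rw [h6]
    exact h5
  have hwall : ∀ j, j + 1 < n → C.BilliardStep L (wall j) (wall (j + 1)) := fun j hj => by
    have h2 := hxs j
    have h3 := hxs (j + 1)
    have h4 : 0 < -C.width / s := div_pos_of_neg_of_neg (by linarith) hsin
    have h5 := billiardStep_wall (v := (c, e (j + 1) * s)) hL (hwallb j (by lia)) h4
      (hxmem (j + 1) hj) (hwallmem (j + 1 + 1)) (by
        ext
        · simp only [wall, Prod.fst_add, Prod.smul_fst, smul_eq_mul]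
          refine mul_right_cancel₀ hsin.ne ?_
          have hq : -C.width / s * s = -C.width := div_mul_cancel₀ _ hsin.ne
          push_cast at h3
          linear_combination h3 - h2 - c * hq
        · simp only [wall, Prod.snd_add, Prod.smul_snd, smul_eq_mul]
          rw [hes (j + 1), mul_comm (e (j + 1)) s, ← mul_assoc, div_mul_cancel₀ _ hsin.ne]
          ring) (mul_ne_zero (by rcases he (j + 1) with h | h <;> rw [h] <;> norm_num) hsin.ne)
    have h6 : wall (j + 1) = ((x (j + 1), e (j + 1 + 1) * (C.width / 2)), (c, -(e (j + 1) * s))) := by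
      simp only [wall, hes (j + 1), neg_mul]
    rw [h6]
    exact h5
  have hfinal : C.BilliardStep L (wall (n - 1)) (tableSymm L (e n) (C.stateAfter z)) := by
    have h0 : C.IsHit z (C.hit z) := hz 0 N.succ_pos
    have hn1 : n - 1 + 1 = n := Nat.sub_add_cancel hn
    have hb := mem_tableBoundary_symm (hwallb (n - 1) (by lia)) (he n)
    have hd : (-c, e n * (e n * s)) = dir z.2 := by
      rw [hdir, ← mul_assoc, hee, one_mul]
    -- Applying the symmetry turns the flight into the left arc into a flight along `z` towards `Γ`,
    -- where `IsHit.billiardStep` applies.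
    have hsymm : wall (n - 1) = tableSymm L (e n)
        ((-(wall (n - 1)).1.1 - L, e n * (wall (n - 1)).1.2), dir z.2) := by
      have := tableSymm_involutive (L := L) (hee n) (wall (n - 1))
      refine this.symm.trans (congrArg _ (Prod.ext rfl ?_))
      simp only [tableSymm, wall, hn1]
      exact hd
    rw [hsymm]
    refine BilliardStep.symm ?_ (he n)
    have h1 := h0.2.1
    rw [dot] at h1
    simp only [perp, hdir] at h1
    have h2 := hxs (n - 1)
    rw [Nat.cast_sub hn, Nat.cast_one] at h2
    have h3 := hΓ0 0 N.zero_le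
    simp only [Function.iterate_zero, id] at h3
    have h4 : 0 < ((C.Γ (C.hit z)).1 + x (n - 1) + L) / -c :=
      div_pos (by linarith [(hxmem (n - 1) (by lia)).1]) (by linarith)
    refine h0.billiardStep hL hb h4 ?_
    rw [hdir]
    have hc' : -c ≠ 0 := neg_ne_zero.2 hcos.ne
    ext
    · simp only [wall, Prod.fst_add, Prod.smul_fst, smul_eq_mul]
      rw [div_mul_cancel₀ _ hc']
      ring
    · simp only [wall, Prod.snd_add, Prod.smul_snd, smul_eq_mul, hn1]
      rw [← mul_assoc, hee, one_mul, div_mul_eq_mul_div, ← sub_eq_iff_eq_add', eq_div_iff hc']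
      linear_combination h1 - h2 + hflight
  obtain ⟨W, hW1, hW2, hW3⟩ := exists_periodic_of_involutive (step := C.BilliardStep L)
    (M := tableSymm L (e n)) (m := N + 1 + n) (w := w) (tableSymm_involutive (hee n))
    (fun _ _ h => h.symm (he n)) (by lia) (fun k hk => by
      rcases lt_trichotomy k N with h | h | h
      · simp only [w, if_pos h.le, if_pos (Nat.succ_le_of_lt h)]
        exact harc k h
      · subst h
        simp only [w, if_pos le_rfl, if_neg (Nat.not_succ_le_self k), Nat.sub_self]
        exact hfirst
      · simp only [w, if_neg (not_le.2 h), if_neg (not_le.2 (h.trans k.lt_succ_self))]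
        have := hwall (k - (N + 1)) (by lia)
        rwa [show k - (N + 1) + 1 = k + 1 - (N + 1) by lia] at this) (by
      simp only [w, if_neg (show ¬N + 1 + n - 1 ≤ N by lia), if_pos N.zero_le]
      rw [show N + 1 + n - 1 - (N + 1) = n - 1 by lia]
      exact hfinal)
  refine ⟨W, ⟨by lia, hW1, hW2⟩, fun k hk => ?_⟩
  rw [hW3 k (by lia)]
  simp only [w, if_pos hk]

end CurvedComponent

/-! ### Trajectories near the reference trajectory -/

namespace CompleteSymmetricSequence

open CurvedComponent

variable {C : CurvedComponent} (O : CompleteSymmetricSequence C)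

/-- The line `z` is reflected off `Γ` like the reference trajectory: it flies forward between the
reflections, and comes in and goes out through the chord of `Γ`. -/
def IsNearReference (O : CompleteSymmetricSequence C) (z : ℝ × ℝ) : Prop :=
  C.HitsTimes (O.last + 1) z ∧
  (∀ k < O.last, 0 < dot (C.Γ (C.hit (C.reflectLine^[k + 1] z))
      - C.Γ (C.hit (C.reflectLine^[k] z))) (dir (C.reflectLine^[k + 1] z).2)) ∧
  Real.cos (C.reflectLine^[O.last + 1] z).2 < 0 ∧
  Real.sin (C.reflectLine^[O.last + 1] z).2 < 0 ∧
  z.1 < -(C.width / 2 * Real.cos (C.reflectLine^[O.last + 1] z).2) ∧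
  (C.reflectLine^[O.last + 1] z).1 <
    -(C.width / 2 * Real.cos (C.reflectLine^[O.last + 1] z).2)

theorem exists_ω_last_eq : ∃ j : ℤ, O.ω (O.last + 1) = O.ωOut + 2 * Real.pi * j := O.angle_out

theorem dir_last : dir (O.ω (O.last + 1)) = dir O.ωOut := by
  obtain ⟨j, hj⟩ := O.exists_ω_last_eq
  rw [hj, dir_add_int_mul_two_pi]

theorem dir_three_pi_sub (ω : ℝ) : dir (3 * Real.pi - ω) = (-Real.cos ω, Real.sin ω) := by
  rw [show 3 * Real.pi - ω = Real.pi - ω + 2 * Real.pi by ring, dir, Real.cos_add_two_pi,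
    Real.sin_add_two_pi, Real.cos_pi_sub, Real.sin_pi_sub]

theorem isNearReference_zero : O.IsNearReference (O.inLine 0) := by
  have hcos : Real.cos (O.ω (O.last + 1)) = Real.cos O.ωOut := congrArg Prod.fst O.dir_last
  have hsin : Real.sin (O.ω (O.last + 1)) = Real.sin O.ωOut := congrArg Prod.snd O.dir_last
  have hc := O.cos_ωOut_neg
  have hc0 : Real.cos (O.ω 0) = -Real.cos O.ωOut := by
    have := congrArg Prod.fst (dir_three_pi_sub (O.ω 0))
    simp only [dir] at this
    rw [ωOut, this, neg_neg]
  refine ⟨O.hitsTimes_inLine_zero, fun k hk => ?_, ?_, ?_, ?_, ?_⟩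
  · obtain ⟨h1, h2⟩ := O.iterate_inLine_zero (k := k) hk.le
    obtain ⟨h3, h4⟩ := O.iterate_inLine_zero (k := k + 1) hk
    obtain ⟨τ, hτ, h5⟩ := O.flight k hk
    rw [h2.hit_eq, h4.hit_eq, h3, h5]
    have h6 : dot (C.Γ (O.s k) + τ • dir (O.ω (k + 1)) - C.Γ (O.s k)) (dir (O.ω (k + 1))) = τ := by
      simp only [dot, dir, add_sub_cancel_left, Prod.smul_fst, Prod.smul_snd, smul_eq_mul]
      linear_combination τ * Real.sin_sq_add_cos_sq (O.ω (k + 1))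
    rw [h6]
    exact hτ
  · rw [iterate_inLine_zero_last, hcos]
    exact hc
  · rw [iterate_inLine_zero_last, hsin]
    exact O.sin_ωOut_neg
  -- The trajectory descends on the way in, so only the upper end of the chord matters here; on the
  -- way out only the lower end does.
  · obtain ⟨τ, -, h1, -, h2⟩ := O.comes_in
    rw [iterate_inLine_zero_last, hcos]
    simp only [inLine, Prod.fst_zero, Prod.snd_zero, add_zero, zero_add, dot_perp_dir]
    simp only [dir, Prod.fst_sub, Prod.snd_sub, Prod.smul_fst, Prod.smul_snd, smul_eq_mul] at h1 h2
    have h3 : (C.Γ (O.s 0)).1 = τ * Real.cos (O.ω 0) := by linarith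
    have h4 := mul_lt_mul_of_pos_right h2 (neg_pos.2 hc)
    rw [h3, hc0]
    linarith
  · obtain ⟨τ, -, h1, h2, -⟩ := O.goes_out
    rw [iterate_inLine_zero_last, dot_perp_dir, hcos, hsin]
    simp only [dir, Prod.fst_add, Prod.snd_add, Prod.smul_fst, Prod.smul_snd, smul_eq_mul,
      hcos, hsin] at h1 h2
    have h3 : (C.Γ (O.s O.last)).1 = -(τ * Real.cos O.ωOut) := by linarith
    rw [h3]
    nlinarith

/-- All conditions are strict inequalities in quantities continuous at the reference line, and
finitely many of them. -/
theorem eventually_isNearReference :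
    ∀ᶠ q in 𝓝 (0 : ℝ × ℝ), O.IsNearReference (O.inLine q) := by
  obtain ⟨h0, h1, h2, h3, h4, h5⟩ := O.isNearReference_zero
  have hin : ContinuousAt O.inLine 0 := O.contDiff_inLine.continuous.continuousAt
  have hiter : ∀ k ≤ O.last + 1, ContinuousAt (fun q => C.reflectLine^[k] (O.inLine q)) 0 :=
    fun k hk => ContinuousAt.comp (h0.mono hk).contDiffAt.continuousAt hin
  have hΓ : ∀ k ≤ O.last, ContinuousAt (fun q => C.Γ (C.hit (C.reflectLine^[k] (O.inLine q)))) 0 :=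
    fun k hk => by
      have hk' := h0 k (Nat.lt_succ_iff.2 hk)
      have e1 : ContinuousAt (fun q => C.hit (C.reflectLine^[k] (O.inLine q))) 0 :=
        ContinuousAt.comp (g := C.hit) hk'.contDiffAt_hit.1.continuousAt
          (hiter k (hk.trans (Nat.le_succ _)))
      exact ContinuousAt.comp (g := C.Γ) (contDiffAt_Γ hk'.1).continuousAt e1
  have hlast := hiter _ le_rfl
  have hcos : ContinuousAt
      (fun q => Real.cos (C.reflectLine^[O.last + 1] (O.inLine q)).2) 0 :=
    Real.continuous_cos.continuousAt.comp hlast.snd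
  have hsin : ContinuousAt
      (fun q => Real.sin (C.reflectLine^[O.last + 1] (O.inLine q)).2) 0 :=
    Real.continuous_sin.continuousAt.comp hlast.snd
  have hfwd : ∀ᶠ q in 𝓝 (0 : ℝ × ℝ), ∀ k ∈ Finset.range O.last,
      0 < dot (C.Γ (C.hit (C.reflectLine^[k + 1] (O.inLine q)))
        - C.Γ (C.hit (C.reflectLine^[k] (O.inLine q))))
          (dir (C.reflectLine^[k + 1] (O.inLine q)).2) := by
    refine (Finset.eventually_all _).2 fun k hk => ?_
    have hk := Finset.mem_range.1 hk
    have e1 := (hΓ (k + 1) hk).sub (hΓ k hk.le)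
    have e2 := (hiter (k + 1) (by lia)).snd
    have e3 : ContinuousAt (fun q => dot (C.Γ (C.hit (C.reflectLine^[k + 1]
        (O.inLine q))) - C.Γ (C.hit (C.reflectLine^[k] (O.inLine q))))
          (dir (C.reflectLine^[k + 1] (O.inLine q)).2)) 0 :=
      (e1.fst.mul (Real.continuous_cos.continuousAt.comp e2)).add
        (e1.snd.mul (Real.continuous_sin.continuousAt.comp e2))
    exact e3.eventually (lt_mem_nhds (h1 k hk))
  have hbound := (hcos.const_mul (C.width / 2)).neg
  filter_upwards [O.eventually_hitsTimes, hfwd, hcos.eventually (gt_mem_nhds h2),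
    hsin.eventually (gt_mem_nhds h3), hin.fst.eventually_lt hbound h4,
    hlast.fst.eventually_lt hbound h5] with q g0 g1 g2 g3 g4 g5
  exact ⟨g0, fun k hk => g1 k (Finset.mem_range.2 hk), g2, g3, g4, g5⟩

/-- Because `F` preserves `f y` and flips `y`, the incoming and outgoing lines have the same first
coordinate, and the definition of `sep` becomes the closing condition for the flight. -/
theorem exists_isPeriodicOrbit {f : ℝ → ℝ} {y : ℝ} (hF : O.F (f y, y) = (f y, -y))
    (hy : O.IsNearReference (O.inLine (f y, y))) {n : ℕ} (hn : 0 < n)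
    (hL : 0 ≤ O.sep f n y) : ∃ z : ℕ → (ℝ × ℝ) × (ℝ × ℝ),
      C.IsPeriodicOrbit (O.sep f n y) (2 * (O.last + 1 + n)) z ∧
        ∀ k ≤ O.last, z k = C.stateAfter (C.reflectLine^[k] (O.inLine (f y, y))) := by
  obtain ⟨h0, h1, h2, h3, h4, h5⟩ := hy
  obtain ⟨j, hj⟩ := O.exists_ω_last_eq
  set z' := C.reflectLine^[O.last + 1] (O.inLine (f y, y)) with hz'
  have hF' : O.outCoord z' = (f y, -y) := hF
  have e1 : z'.2 = O.ωOut - y + 2 * Real.pi * j := by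
    have := congrArg Prod.snd hF'
    simp only [outCoord] at this
    linarith
  have e2 : dir z'.2 = dir (O.ωOut - y) := by rw [e1, dir_add_int_mul_two_pi]
  have ec : Real.cos z'.2 = Real.cos (O.ωOut - y) := congrArg Prod.fst e2
  have es : Real.sin z'.2 = Real.sin (O.ωOut - y) := congrArg Prod.snd e2
  have e3 : z'.1 = f y + dot (C.Γ (O.s O.last)) (perp (dir (O.ωOut - y))) := by
    have := congrArg Prod.fst hF'
    simp only [outCoord] at this
    rw [← e2]
    linarith
  have e4 : O.ω 0 + y = 3 * Real.pi - (O.ωOut - y) := by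
    rw [ωOut]
    ring
  have e5 : (O.inLine (f y, y)).1 =
      f y + dot (C.Γ (O.s O.last)) (perp (dir (O.ωOut - y))) := by
    simp only [inLine]
    rw [e4, show 3 * Real.pi - (O.ωOut - y) = Real.pi - (O.ωOut - y) + 2 * Real.pi * (1 : ℤ) by
      push_cast; ring, dir_add_int_mul_two_pi, dot_Γ_first]
  refine CurvedComponent.exists_isPeriodicOrbit hL hn O.width_pos h0 h1 hz'.symm h2 h3 ?_ ?_ h4 h5
  · rw [ec, es, ← dir_three_pi_sub, ← e4]
    rfl
  · rw [e5, e3, ec, es, sep, div_mul_cancel₀ _ (by rw [← es]; exact h3.ne)]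
    ring

end CompleteSymmetricSequence

/-! ### Choice of constants and conclusion -/

theorem mainTheorem8 (C : CurvedComponent) (O : CompleteSymmetricSequence C)
    (β : ℝ) (hβ : β ≠ 0) (hlin : O.HasLinearization β) (ha : O.a20 ≠ 0) :
    ∃ ε > 0, ∃ δ > 0, ∃ f : ℝ → ℝ, O.IsSymmetryFunction β ε δ f ∧
    ∃ n₀ : ℕ, 0 < n₀ ∧ ∃ Υ : ℕ → ℝ → ℝ,
      -- the functions `Υ n`: for `n ≥ n₀` and `-1 ≤ t ≤ 5` the monodromy trace at `y` is `2 - t`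
      -- if and only if `y = Υ n t`
      (∀ n ≥ n₀,
        (∀ y ∈ Ioo (-ε) ε, DifferentiableAt ℝ (O.returnMap f n y) 0) ∧
        ∀ t ∈ Icc (-1 : ℝ) 5, Υ n t ∈ Ioo (-ε) ε ∧
          ∀ y ∈ Ioo (-ε) ε, O.monodromyTrace f n y = 2 - t ↔ y = Υ n t) ∧
      -- the periodic orbit through the state with coordinates `(f y, y)`, `y = Υ n (2 - Θ)`, on
      -- the table with separation distance `L_n(y)`, and the trace of its monodromy matrix
      (∀ n ≥ n₀, ∀ Θ ∈ Icc (-3 : ℝ) 3,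
        0 < O.sep f n (Υ n (2 - Θ)) ∧
        (∃ z : ℕ → (ℝ × ℝ) × (ℝ × ℝ),
          C.IsPeriodicOrbit (O.sep f n (Υ n (2 - Θ))) (2 * (O.last + 1 + n)) z ∧
          ∀ k ≤ O.last, z k =
            C.stateAfter (C.reflectLine^[k] (O.inLine (f (Υ n (2 - Θ)), Υ n (2 - Θ))))) ∧
        O.returnMap f n (Υ n (2 - Θ)) 0 = 0 ∧
        O.monodromyTrace f n (Υ n (2 - Θ)) = Θ) ∧
      -- the asymptotics of the separation distance, uniform in `Θ`
      ∃ K : ℝ, ∀ n ≥ n₀, ∀ Θ ∈ Icc (-3 : ℝ) 3,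
        |O.sep f n (Υ n (2 - Θ)) - O.sep f n 0 - (2 - Θ) / (2 * O.a20 * Real.sin O.ωOut)|
          ≤ K / n := by
  obtain ⟨ε₀, hε₀, δ, hδ, f, hf4, hsym⟩ := hlin.exists_isSymmetryFunction hβ
  have hf0 : f 0 = 0 := (hsym ε₀ le_rfl).1
  have hs := O.sin_ωOut_neg
  have hW := O.width_pos
  have hqne : deriv (O.traceSlope f) 0 ≠ 0 := by
    rw [hlin.deriv_traceSlope hf4 hf0]
    exact div_ne_zero (mul_ne_zero (mul_ne_zero two_ne_zero ha) hW.ne') hs.ne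
  -- The symmetric range `[-5, 5]` contains the required values `-1 ≤ t ≤ 5`.
  obtain ⟨ε₁, hε₁, hsol⟩ := exists_solution_of_ne_zero (O.contDiffAt_traceConst hf4 hf0)
    (O.contDiffAt_traceSlope hf4 hf0) (O.contDiffAt_sepConst hf4) O.contDiffAt_sepSlope
    (hlin.traceConst_zero hf0) (hlin.traceSlope_zero hf0) hqne 5
  have hcurve : Tendsto (fun y => (f y, y)) (𝓝 0) (𝓝 (0 : ℝ × ℝ)) := by
    have h := hf4.continuousAt.tendsto
    rw [hf0] at h
    exact h.prodMk_nhds tendsto_id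
  have hslope : 0 < O.sepSlope 0 := by
    rw [CompleteSymmetricSequence.sepSlope, sub_zero]
    exact div_pos_of_neg_of_neg (mul_neg_of_pos_of_neg hW O.cos_ωOut_neg) hs
  have hsin : ∀ᶠ y in 𝓝 (0 : ℝ), Real.sin (O.ωOut - y) < 0 :=
    (Real.continuous_sin.comp (continuous_const.sub continuous_id)).continuousAt.eventually
      (gt_mem_nhds (by simpa using hs))
  obtain ⟨ε₂, hε₂, hnear⟩ := Metric.eventually_nhds_iff.1
    ((((hcurve.eventually O.eventually_isNearReference).and hsin).and
      (O.contDiffAt_sepSlope.continuousAt.eventually (lt_mem_nhds (half_lt_self hslope)))).and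
      ((O.contDiffAt_sepConst hf4).continuousAt.eventually
        (lt_mem_nhds (sub_one_lt (O.sepConst f 0)))))
  set ε := min ε₀ (min ε₁ ε₂) with hε
  have hεpos : 0 < ε := lt_min hε₀ (lt_min hε₁ hε₂)
  have hsymε := hsym ε (min_le_left _ _)
  obtain ⟨n₁, hn₁, Υ, K, hΥ⟩ := hsol ε hεpos ((min_le_right _ _).trans (min_le_left _ _))
  -- Near `0` the separation distance exceeds `sepConst f 0 - 1 + n * (sepSlope 0 / 2)`, which is
  -- positive for `n ≥ n₂`.
  obtain ⟨n₂, hn₂⟩ := exists_nat_gt ((1 - O.sepConst f 0) / (O.sepSlope 0 / 2))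
  have hnear' : ∀ y ∈ Ioo (-ε) ε, ((O.IsNearReference (O.inLine (f y, y)) ∧
      Real.sin (O.ωOut - y) < 0) ∧ O.sepSlope 0 / 2 < O.sepSlope y) ∧
        O.sepConst f 0 - 1 < O.sepConst f y := fun y hy => by
    refine hnear ?_
    rw [Real.dist_0_eq_abs]
    exact (abs_lt.2 hy).trans_le ((min_le_right _ _).trans (min_le_right _ _))
  have hF : ∀ y ∈ Ioo (-ε) ε, O.F (f y, y) = (f y, -y) := fun y hy =>
    ((hsymε.2.2.2 y hy).2 (f y) (hsymε.2.2.2 y hy).1).2 rfl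
  have htrace : ∀ n ≥ max n₁ n₂, ∀ t ∈ Icc (-1 : ℝ) 5, Υ n t ∈ Ioo (-ε) ε ∧
      ∀ y ∈ Ioo (-ε) ε, O.monodromyTrace f n y = 2 - t ↔ y = Υ n t := fun n hn t ht => by
    obtain ⟨h1, h2, -⟩ := hΥ n (le_of_max_le_left hn) t ⟨by linarith [ht.1], ht.2⟩
    refine ⟨h1, fun y hy => ?_⟩
    rw [← h2 y hy, ← O.two_sub_monodromyTrace (hF y hy) (hnear' y hy).1.1.1.1]
    constructor <;> intro <;> linarith
  refine ⟨ε, hεpos, δ, hδ, f, hsymε, max n₁ n₂, lt_max_of_lt_left hn₁, Υ,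
    fun n hn => ⟨fun y hy =>
      (O.hasFDerivAt_returnMap (hF y hy) (hnear' y hy).1.1.1.1 n).differentiableAt, htrace n hn⟩,
    fun n hn Θ hΘ => ?_, K, fun n hn Θ hΘ => ?_⟩
  · have ht : 2 - Θ ∈ Icc (-1 : ℝ) 5 := ⟨by linarith [hΘ.2], by linarith [hΘ.1]⟩
    obtain ⟨hy, hiff⟩ := htrace n hn _ ht
    set y := Υ n (2 - Θ)
    obtain ⟨⟨⟨h1, h2⟩, h3⟩, h4⟩ := hnear' y hy
    have hn' : (n₂ : ℝ) ≤ n := by exact_mod_cast le_of_max_le_right hn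
    have hL : 0 < O.sep f n y := by
      have h5 := hn₂.trans_le hn'
      rw [div_lt_iff₀ (by positivity)] at h5
      have h6 : (n : ℝ) * (O.sepSlope 0 / 2) ≤ n * O.sepSlope y := by gcongr
      rw [O.sep_eq]
      linarith
    refine ⟨hL, O.exists_isPeriodicOrbit (hF y hy) h1 (hn₁.trans_le (le_of_max_le_left hn)) hL.le,
      O.returnMap_zero (hF y hy) h2.ne n, ?_⟩
    rw [(hiff y hy).2 rfl, sub_sub_cancel]
  · have ht : 2 - Θ ∈ Icc (-5 : ℝ) 5 := ⟨by linarith [hΘ.2], by linarith [hΘ.1]⟩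
    have h := (hΥ n (le_of_max_le_left hn) _ ht).2.2
    have e : deriv O.sepSlope 0 / deriv (O.traceSlope f) 0 * (2 - Θ) =
        (2 - Θ) / (2 * O.a20 * Real.sin O.ωOut) := by
      rw [hlin.deriv_traceSlope hf4 hf0, O.deriv_sepSlope]
      have := hs.ne
      have := hW.ne'
      field_simp
    rw [O.sep_eq, O.sep_eq, ← e]
    exact h
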